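/- Let $-\infty\le a<b\le\infty$ and let $p,q,r$ be real-valued measurable functions on $(a,b)$ with $p,r>0$ a.e. and $1/p,\,q,\,r\in L^1_{loc}((a,b))$. Put $\tau f=\frac1r\left[-(f^{[1]})'+qf\right]$ with $f^{[1]}=pf'$, and $W(f,g)=fg^{[1]}-f^{[1]}g$. A solution of $\tau f=zf$ ($z\in\mathbb C$) is a function $f:(a,b)\to\mathbb C$ with $f,f^{[1]}\in AC_{loc}((a,b))$ satisfying the equation a.e. on $(a,b)$. Let $\mathrm{dom}(T_{max})$ be the set of $g\in L^2((a,b);r\,dx)$ with $g,g^{[1]}\in AC_{loc}((a,b))$ and $\tau g\in L^2((a,b);r\,dx)$. Assume that $\tau$ is quasi-regular on $(a,b)$: for every $z\in\mathbb C$ all solutions of $\tau f=zf$ are in $L^2(r\,dx)$ near $a$ and near $b$. Let $\lambda_0\in\mathbb R$ and, for each endpoint $x_0\in\{a,b\}$, let $u_{x_0}$ and $\widehat u_{x_0}$ be real-valued solutions of $\tau u=\lambda_0u$ on $(a,b)$ with $W(\widehat u_{x_0},u_{x_0})=1$, where $u_{x_0}$ is principal at $x_0$, i.e. nonvanishing near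 $x_0$ with $p^{-1}u_{x_0}^{-2}$ not integrable near $x_0$ (so that $\widehat u_{x_0}$ is nonprincipal; such solutions exist, in particular, whenever the minimal operator $T_{min}$ satisfies $T_{min}\ge\lambda_0I$). For $g\in\mathrm{dom}(T_{max})$ the generalized boundary values are $$\widetilde g(x_0)=-W(u_{x_0},g)(x_0)=\lim_{x\to x_0}\frac{g(x)}{\widehat u_{x_0}(x)},\qquad \widetilde g^{\,\prime}(x_0)=W(\widehat u_{x_0},g)(x_0)=\lim_{x\to x_0}\frac{g(x)-\widetilde g(x_0)\,\widehat u_{x_0}(x)}{u_{x_0}(x)},$$ where $W(\cdot,\cdot)(x_0)$ denotes the limit of the Wronskian at $x_0$, and $$\widetilde W(f,g)(x_0)=\widetilde f(x_0)\,\widetilde g^{\,\prime}(x_0)-\widetilde f^{\,\prime}(x_0)\,\widetilde g(x_0).$$ Fix $z\in\mathbb C$. Let $f_1$ be a solution of $\tau f_1=zf_1$, and let $f_2(\zeta,\cdot)$, for $\zeta$ in a neighbourhood of $z$, be solutions of $\tau f_2(\zeta,\cdot)=\zeta f_2(\zeta,\cdot)$ such that $\zeta\mapsto f_2(\zeta,x)$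 is complex differentiable at $z$ for every $x\in(a,b)$; put $\dot f_2(x)=\frac{\partial}{\partial \zeta}f_2(\zeta,x)\big|_{\zeta=z}$. Then $f_1,\dot f_2\in\mathrm{dom}(T_{max})$, all the above limits for $g=f_1$ and $g=\dot f_2$ exist at both endpoints and the two expressions for each boundary value agree, $r f_1f_2(z,\cdot)$ is integrable on $(a,b)$, and $$\int_a^b r(x)\,f_1(x)\,f_2(z,x)\,dx=\widetilde W(f_1,\dot f_2)(a)-\widetilde W(f_1,\dot f_2)(b).$$ -/

import Mathlib

open MeasureTheory Filter Topology Set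

/-- The standing data: an open interval `(a,b) ⊆ ℝ`, bounded or unbounded, and real coefficients
`p, q, r` with `p, r > 0` a.e. and `1/p, q, r` locally integrable on `(a,b)`.
(Lebesgue measurability of the coefficients on `(a,b)` is part of local integrability.) -/
structure SturmLiouville where
  a : EReal
  b : EReal
  a_lt_b : a < b
  p : ℝ → ℝ
  q : ℝ → ℝ
  r : ℝ → ℝ
  r_pos : ∀ᵐ x : ℝ, a < (x : EReal) → (x : EReal) < b → 0 < r x
  p_pos : ∀ᵐ x : ℝ, a < (x : EReal) → (x : EReal) < b → 0 < p x
  r_loc : LocallyIntegrableOn r {x : ℝ | a < (x : EReal) ∧ (x : EReal) < b}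
  p_inv_loc : LocallyIntegrableOn (fun x => 1 / p x) {x : ℝ | a < (x : EReal) ∧ (x : EReal) < b}
  q_loc : LocallyIntegrableOn q {x : ℝ | a < (x : EReal) ∧ (x : EReal) < b}

noncomputable section

namespace SturmLiouville

variable (T : SturmLiouville)

/-- The open interval `(a,b)`, as a set of real numbers. -/
def I : Set ℝ := {x : ℝ | T.a < (x : EReal) ∧ (x : EReal) < T.b}

/-- The filter `x ↓ a` on the real line (it is `atBot` if `a = -∞`). -/
def atLeft : Filter ℝ := comap Real.toEReal (𝓝[>] T.a)

/-- The filter `x ↑ b` on the real line (it is `atTop` if `b = ∞`). -/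
def atRight : Filter ℝ := comap Real.toEReal (𝓝[<] T.b)

/-- `AC_loc((a,b))`: absolute continuity on every compact subinterval. -/
def ACLoc (f : ℝ → ℂ) : Prop :=
  ∀ c ∈ T.I, ∀ d ∈ T.I, AbsolutelyContinuousOnInterval f c d

/-- `v` is the locally absolutely continuous version on `(a,b)` of `p f'`. -/
def IsQuasiDeriv (f v : ℝ → ℂ) : Prop :=
  T.ACLoc v ∧ ∀ᵐ x : ℝ, x ∈ T.I → v x = (T.p x : ℂ) * deriv f x

/-- `f, f^[1] ∈ AC_loc((a,b))`, where `f^[1] = p f'`. -/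
def Regular (f : ℝ → ℂ) : Prop :=
  T.ACLoc f ∧ ∃ v, T.IsQuasiDeriv f v

open Classical in
/-- The first quasi-derivative `f^[1] = p f'`. As `p f'` is determined only almost everywhere, its
locally absolutely continuous version is taken when there is one; that version is unique on
`(a,b)`, see `eqOn_quasiDeriv`. -/
def quasiDeriv (f : ℝ → ℂ) : ℝ → ℂ :=
  if h : ∃ v, T.IsQuasiDeriv f v then h.choose else fun x => (T.p x : ℂ) * deriv f x

/-- The differential expression `τ f = r⁻¹ (-(p f')' + q f)`. -/
def tau (f : ℝ → ℂ) (x : ℝ) : ℂ :=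
  (T.r x : ℂ)⁻¹ * (-deriv (T.quasiDeriv f) x + (T.q x : ℂ) * f x)

/-- The Wronskian `W(f,g)(x) = f(x) g^[1](x) - f^[1](x) g(x)`. -/
def wronskian (f g : ℝ → ℂ) (x : ℝ) : ℂ :=
  f x * T.quasiDeriv g x - T.quasiDeriv f x * g x

/-- `f` is a solution of `τ f = z f` on `(a,b)`. -/
def IsSolution (z : ℂ) (f : ℝ → ℂ) : Prop :=
  T.Regular f ∧ ∀ᵐ x : ℝ, x ∈ T.I → T.tau f x = z * f x

/-- `f ∈ L²((a,b); r dx)` near `a`. -/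
def SqIntegrableNearLeft (f : ℝ → ℂ) : Prop :=
  ∃ c ∈ T.I, IntegrableOn (fun x => T.r x * ‖f x‖ ^ 2) {x | x ∈ T.I ∧ x < c}

/-- `f ∈ L²((a,b); r dx)` near `b`. -/
def SqIntegrableNearRight (f : ℝ → ℂ) : Prop :=
  ∃ c ∈ T.I, IntegrableOn (fun x => T.r x * ‖f x‖ ^ 2) {x | x ∈ T.I ∧ c < x}

/-- `τ` is quasi-regular on `(a,b)`: it is in the limit circle case at `a` and at `b`, that is,
for every `z ∈ ℂ` all solutions of `τ f = z f` are in `L²((a,b); r dx)` near `a` and near `b`. -/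
def QuasiRegular : Prop :=
  (∀ (z : ℂ) (f : ℝ → ℂ), T.IsSolution z f → T.SqIntegrableNearLeft f) ∧
  (∀ (z : ℂ) (f : ℝ → ℂ), T.IsSolution z f → T.SqIntegrableNearRight f)

/-- `g ∈ dom(T_max)`: `g, g^[1] ∈ AC_loc((a,b))` and `g, τ g ∈ L²((a,b); r dx)`. -/
def MemDomMax (g : ℝ → ℂ) : Prop :=
  T.Regular g ∧ IntegrableOn (fun x => T.r x * ‖g x‖ ^ 2) T.I ∧
    IntegrableOn (fun x => T.r x * ‖T.tau g x‖ ^ 2) T.I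

/-- `u` is a (real-valued) principal solution of `τ u = lam u` at `a`. -/
def IsPrincipalLeft (lam : ℝ) (u : ℝ → ℝ) : Prop :=
  T.IsSolution lam (fun x => (u x : ℂ)) ∧ ∃ c ∈ T.I, (∀ x ∈ T.I, x ≤ c → u x ≠ 0) ∧
    ∫⁻ x in {x | x ∈ T.I ∧ x ≤ c}, ENNReal.ofReal (1 / (T.p x * u x ^ 2)) = ⊤

/-- `u` is a (real-valued) principal solution of `τ u = lam u` at `b`. -/
def IsPrincipalRight (lam : ℝ) (u : ℝ → ℝ) : Prop :=
  T.IsSolution lam (fun x => (u x : ℂ)) ∧ ∃ c ∈ T.I, (∀ x ∈ T.I, c ≤ x → u x ≠ 0) ∧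
    ∫⁻ x in {x | x ∈ T.I ∧ c ≤ x}, ENNReal.ofReal (1 / (T.p x * u x ^ 2)) = ⊤

/-- `w` is a real-valued solution of `τ w = lam w` with `W(w,u) = 1`. If `u` is a principal solution
at an endpoint, then `w` is linearly independent of it, i.e. `w` is nonprincipal there, and the
pair is normalized. -/
def IsNormalizedPartner (lam : ℝ) (w u : ℝ → ℝ) : Prop :=
  T.IsSolution lam (fun x => (w x : ℂ)) ∧
    ∀ x ∈ T.I, T.wronskian (fun y => (w y : ℂ)) (fun y => (u y : ℂ)) x = 1

/-- The generalized boundary value `g~ = -W(u,g)` at the endpoint that is described by the filter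
`l`, for a principal solution `u` at that endpoint. -/
def bdryVal (l : Filter ℝ) (u : ℝ → ℝ) (g : ℝ → ℂ) : ℂ :=
  limUnder l (fun x => -T.wronskian (fun y => (u y : ℂ)) g x)

/-- The generalized boundary value `g~' = W(w,g)` at the endpoint that is described by the filter
`l`, for a nonprincipal solution `w` at that endpoint. -/
def bdryDeriv (l : Filter ℝ) (w : ℝ → ℝ) (g : ℝ → ℂ) : ℂ :=
  limUnder l (T.wronskian (fun y => (w y : ℂ)) g)

/-- The generalized boundary values of `g` exist at the endpoint described by `l`, both as limits of
Wronskians and, with the same values, as the limits `g~ = lim g / w` and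
`g~' = lim (g - g~ w) / u`. -/
def HasBdryValues (l : Filter ℝ) (w u : ℝ → ℝ) (g : ℝ → ℂ) : Prop :=
  Tendsto (fun x => -T.wronskian (fun y => (u y : ℂ)) g x) l (𝓝 (T.bdryVal l u g)) ∧
  Tendsto (T.wronskian (fun y => (w y : ℂ)) g) l (𝓝 (T.bdryDeriv l w g)) ∧
  Tendsto (fun x => g x / (w x : ℂ)) l (𝓝 (T.bdryVal l u g)) ∧
  Tendsto (fun x => (g x - T.bdryVal l u g * (w x : ℂ)) / (u x : ℂ)) l (𝓝 (T.bdryDeriv l w g))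

/-- The Wronskian of generalized boundary values, `f~ g~' - f~' g~`. -/
def genWronskian (l : Filter ℝ) (w u : ℝ → ℝ) (f g : ℝ → ℂ) : ℂ :=
  T.bdryVal l u f * T.bdryDeriv l w g - T.bdryDeriv l w f * T.bdryVal l u g

theorem isOpen_I : IsOpen T.I :=
  (isOpen_Ioo (a := T.a) (b := T.b)).preimage continuous_coe_real_ereal

theorem ACLoc.continuousOn {f : ℝ → ℂ} (hf : T.ACLoc f) : ContinuousOn f T.I := by
  intro x hx
  obtain ⟨e, he, hsub⟩ := Metric.isOpen_iff.1 T.isOpen_I x hx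
  have h1 : x - e / 2 ∈ T.I := hsub (by simp [abs_of_pos he]; linarith)
  have h2 : x + e / 2 ∈ T.I := hsub (by simp [abs_of_pos he]; linarith)
  have h3 := (hf _ h1 _ h2).continuousOn
  rw [uIcc_of_le (by linarith)] at h3
  exact (h3.continuousAt (Icc_mem_nhds (by linarith) (by linarith))).continuousWithinAt

/-- The locally absolutely continuous version of `p f'` is unique on `(a,b)`. -/
theorem eqOn_quasiDeriv {f v : ℝ → ℂ} (hv : T.IsQuasiDeriv f v) :
    EqOn v (T.quasiDeriv f) T.I := by
  have h : ∃ v, T.IsQuasiDeriv f v := ⟨v, hv⟩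
  have hc : T.IsQuasiDeriv f (T.quasiDeriv f) := by
    rw [quasiDeriv, dif_pos h]; exact h.choose_spec
  refine MeasureTheory.Measure.eqOn_open_of_ae_eq (μ := volume) ?_ T.isOpen_I
    (ACLoc.continuousOn T hv.1) (ACLoc.continuousOn T hc.1)
  rw [EventuallyEq, ae_restrict_iff' T.isOpen_I.measurableSet]
  filter_upwards [hv.2, hc.2] with x h1 h2 hx
  rw [h1 hx, h2 hx]

end SturmLiouville

end

/-!
Fix a pair `w, u` of real-valued solutions of `τ y = lam y` with `W(w,u) = 1`. Every regular `g` is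
`g = A w + B u` with `A = -W(u,g)` and `B = W(w,g)`, and Lagrange's identity gives
`A' = r u (τ g - lam g)`, `B' = -r w (τ g - lam g)`. By quasi-regularity `r (|u| + |w|)²` is
integrable on all of `(a,b)`, so in the unknowns `A, B` the equation is regular up to both
endpoints. The generalized boundary values of `g` are the limits of `A` and `B`.

* For `g` in the maximal domain `A'` and `B'` are integrable, so these limits exist. That they
  agree with the limits of `g / w` and of `(g - g~ w) / u` follows from
  `(w / u)' = -1 / (p u²)`: if `u` is principal, then `|w / u|` increases to `∞` towards the
  endpoint, which allows `(w / u) (A - lim A)` to be bounded by a tail of the integral of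
  `r |w (τ g - lam g)|` (`IsEndpoint.abs_div_principal`, `IsEndpoint.hasBdryValues`).
* The parameter derivative is only assumed to exist pointwise. Along a sequence `ζ n → z` the
  difference quotients of `f₂` solve `τ y = z y + f₂(ζ n)` and converge pointwise, so Baire's
  theorem bounds them uniformly on some small interval. There dominated convergence applies, and
  the values at two points determine the coefficients, which therefore converge at one point.
  Gronwall's inequality spreads the bounds over `(a,b)`, and dominated convergence then shows that
  the derivative has bounded coefficients and solves `τ y = z y + f₂(z)`
  (`IsFundamentalPair.exists_isVariation_of_tendsto`, `IsFundamentalPair.memDomMax_of_tendsto`).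
* Finally `W(f₁, g)' = -r f₁ f₂(z)` for the derivative `g` of `f₂`, and the limits of `W(f₁, g)` at
  the endpoints are the Wronskians of the boundary values (`HasBdryValues.tendsto_wronskian`).
-/

/-! ### Absolutely continuous complex-valued functions and Gronwall's inequality -/

namespace AbsolutelyContinuousOnInterval

theorem of_dist_le {X Y : Type*} [PseudoMetricSpace X] [PseudoMetricSpace Y] {f : ℝ → X}
    {g : ℝ → Y} {a b K : ℝ} (hf : AbsolutelyContinuousOnInterval f a b)
    (h : ∀ x ∈ uIcc a b, ∀ y ∈ uIcc a b, dist (g x) (g y) ≤ K * dist (f x) (f y)) :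
    AbsolutelyContinuousOnInterval g a b := by
  have hK : Tendsto (fun E : ℕ × (ℕ → ℝ × ℝ) =>
      K * ∑ i ∈ Finset.range E.1, dist (f (E.2 i).1) (f (E.2 i).2))
      (totalLengthFilter ⊓ 𝓟 (disjWithin a b)) (𝓝 0) := by
    have := Tendsto.const_mul K hf
    rwa [mul_zero] at this
  refine squeeze_zero' (Eventually.of_forall fun E => Finset.sum_nonneg fun i _ => dist_nonneg)
    ?_ hK
  filter_upwards [mem_inf_of_right (mem_principal_self _)] with E hE
  rw [Finset.mul_sum]
  exact Finset.sum_le_sum fun i hi => h _ (hE.1 i hi).1 _ (hE.1 i hi).2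

theorem congr {X : Type*} [PseudoMetricSpace X] {f g : ℝ → X} {a b : ℝ}
    (hf : AbsolutelyContinuousOnInterval f a b) (h : EqOn f g (uIcc a b)) :
    AbsolutelyContinuousOnInterval g a b :=
  hf.of_dist_le (K := 1) fun x hx y hy => by rw [h hx, h hy, one_mul]

theorem re {f : ℝ → ℂ} {a b : ℝ} (hf : AbsolutelyContinuousOnInterval f a b) :
    AbsolutelyContinuousOnInterval (fun x => (f x).re) a b :=
  hf.of_dist_le (K := 1) fun x _ y _ => by
    rw [one_mul, dist_eq_norm, dist_eq_norm, ← Complex.sub_re]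
    exact Complex.abs_re_le_norm _

theorem im {f : ℝ → ℂ} {a b : ℝ} (hf : AbsolutelyContinuousOnInterval f a b) :
    AbsolutelyContinuousOnInterval (fun x => (f x).im) a b :=
  hf.of_dist_le (K := 1) fun x _ y _ => by
    rw [one_mul, dist_eq_norm, dist_eq_norm, ← Complex.sub_im]
    exact Complex.abs_im_le_norm _

theorem ofReal {f : ℝ → ℝ} {a b : ℝ} (hf : AbsolutelyContinuousOnInterval f a b) :
    AbsolutelyContinuousOnInterval (fun x => (f x : ℂ)) a b :=
  hf.of_dist_le (K := 1) fun x _ y _ => by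
    rw [one_mul, dist_eq_norm, dist_eq_norm, ← Complex.ofReal_sub, Complex.norm_real]

theorem ae_hasDerivAt {f : ℝ → ℂ} {a b : ℝ} (hf : AbsolutelyContinuousOnInterval f a b) :
    ∀ᵐ x : ℝ, x ∈ uIcc a b → HasDerivAt f (deriv f x) x := by
  filter_upwards [hf.re.ae_differentiableAt, hf.im.ae_differentiableAt] with x h1 h2 hx
  have h := (h1 hx).hasDerivAt.ofReal_comp.add
    ((h2 hx).hasDerivAt.ofReal_comp.mul_const Complex.I)
  have h' : DifferentiableAt ℝ f x := by
    refine (h.differentiableAt).congr_of_eventuallyEq (Eventually.of_forall fun y => ?_)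
    simp
  exact h'.hasDerivAt

/-- The fundamental theorem of calculus for complex-valued absolutely continuous functions. -/
theorem integral_eq_sub_of_ae_hasDerivAt {f f' : ℝ → ℂ} {a b : ℝ}
    (hf : AbsolutelyContinuousOnInterval f a b)
    (h : ∀ᵐ x : ℝ, x ∈ uIcc a b → HasDerivAt f (f' x) x) :
    IntervalIntegrable f' volume a b ∧ ∫ x in a..b, f' x = f b - f a := by
  have hre : ∀ᵐ x : ℝ, x ∈ uIoc a b → deriv (fun x => (f x).re) x = (f' x).re := by
    filter_upwards [h] with x hx hm
    exact (Complex.reCLM.hasFDerivAt.comp_hasDerivAt x (hx (uIoc_subset_uIcc hm))).deriv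
  have him : ∀ᵐ x : ℝ, x ∈ uIoc a b → deriv (fun x => (f x).im) x = (f' x).im := by
    filter_upwards [h] with x hx hm
    exact (Complex.imCLM.hasFDerivAt.comp_hasDerivAt x (hx (uIoc_subset_uIcc hm))).deriv
  have ire : IntervalIntegrable (fun x => (f' x).re) volume a b :=
    hf.re.intervalIntegrable_deriv.congr_ae
      ((ae_restrict_iff' measurableSet_uIoc).2 hre)
  have iim : IntervalIntegrable (fun x => (f' x).im) volume a b :=
    hf.im.intervalIntegrable_deriv.congr_ae
      ((ae_restrict_iff' measurableSet_uIoc).2 him)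
  have e : f' = fun x => ((f' x).re : ℂ) + ((f' x).im : ℂ) * Complex.I := by
    funext x; simp
  have ire' : IntervalIntegrable (fun x => ((f' x).re : ℂ)) volume a b :=
    ⟨ire.1.ofReal, ire.2.ofReal⟩
  have iim' : IntervalIntegrable (fun x => ((f' x).im : ℂ) * Complex.I) volume a b :=
    IntervalIntegrable.mul_const ⟨iim.1.ofReal, iim.2.ofReal⟩ _
  refine ⟨by rw [e]; exact ire'.add iim', ?_⟩
  rw [e, intervalIntegral.integral_add ire' iim', intervalIntegral.integral_mul_const,
    intervalIntegral.integral_ofReal, intervalIntegral.integral_ofReal,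
    ← intervalIntegral.integral_congr_ae hre, ← intervalIntegral.integral_congr_ae him,
    hf.re.integral_deriv_eq_sub, hf.im.integral_deriv_eq_sub]
  apply Complex.ext <;> simp

end AbsolutelyContinuousOnInterval

/-- The primitive of an integrable complex-valued function is absolutely continuous. -/
theorem IntervalIntegrable.absolutelyContinuousOnInterval_complex {f : ℝ → ℂ} {a b c : ℝ}
    (h : IntervalIntegrable f volume a b) (hc : c ∈ uIcc a b) :
    AbsolutelyContinuousOnInterval (fun x => ∫ t in c..x, f t) a b := by
  have ire : IntervalIntegrable (fun x => (f x).re) volume a b := ⟨h.1.re, h.2.re⟩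
  have iim : IntervalIntegrable (fun x => (f x).im) volume a b := ⟨h.1.im, h.2.im⟩
  have hac := (ire.absolutelyContinuousOnInterval_intervalIntegral hc).ofReal.fun_add
    ((iim.absolutelyContinuousOnInterval_intervalIntegral hc).ofReal.const_smul Complex.I)
  refine hac.congr fun x hx => ?_
  have hs : uIcc c x ⊆ uIcc a b := uIcc_subset_uIcc hc hx
  have e : ∀ t, f t = ((f t).re : ℂ) + Complex.I * ((f t).im : ℂ) := fun t => by
    rw [mul_comm, Complex.re_add_im]
  have ire' : IntervalIntegrable (fun x => ((f x).re : ℂ)) volume c x :=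
    ⟨(ire.mono_set hs).1.ofReal, (ire.mono_set hs).2.ofReal⟩
  have iim' : IntervalIntegrable (fun x => Complex.I * ((f x).im : ℂ)) volume c x :=
    IntervalIntegrable.const_mul ⟨(iim.mono_set hs).1.ofReal, (iim.mono_set hs).2.ofReal⟩ _
  rw [intervalIntegral.integral_congr (g := fun t => ((f t).re : ℂ) + Complex.I * ((f t).im : ℂ))
    fun t _ => e t, intervalIntegral.integral_add ire' iim', intervalIntegral.integral_const_mul,
    intervalIntegral.integral_ofReal, intervalIntegral.integral_ofReal]
  rfl

theorem le_mul_exp_of_le_add_integral_of_le {k y : ℝ → ℝ} {a b C : ℝ} (hab : a ≤ b)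
    (hk : IntervalIntegrable k volume a b) (hk0 : ∀ t, 0 ≤ k t) (hy : ContinuousOn y (Icc a b))
    (h : ∀ t ∈ Icc a b, y t ≤ C + ∫ s in a..t, k s * y s) :
    y b ≤ C * Real.exp (∫ s in a..b, k s) := by
  rw [← uIcc_of_le hab] at hy h
  have hky : IntervalIntegrable (fun s => k s * y s) volume a b := hk.mul_continuousOn hy
  set F : ℝ → ℝ := fun t => C + ∫ s in a..t, k s * y s with hF
  set K : ℝ → ℝ := fun t => ∫ s in a..t, k s with hK
  have haF : AbsolutelyContinuousOnInterval F a b :=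
    (hky.absolutelyContinuousOnInterval_intervalIntegral left_mem_uIcc).of_dist_le (K := 1)
      fun x _ y _ => by simp [hF]
  have hK0 : ∀ t ∈ uIcc a b, 0 ≤ K t := fun t ht => by
    rw [uIcc_of_le hab] at ht
    exact intervalIntegral.integral_nonneg ht.1 fun s _ => hk0 s
  have haE : AbsolutelyContinuousOnInterval (fun t => Real.exp (-K t)) a b := by
    refine (hk.absolutelyContinuousOnInterval_intervalIntegral left_mem_uIcc).of_dist_le (K := 1)
      fun x hx y hy => ?_
    -- the exponential function is nonexpansive on `(-∞, 0]`
    have key : ∀ s t : ℝ, 0 ≤ s → s ≤ t → Real.exp (-s) - Real.exp (-t) ≤ t - s := by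
      intro s t hs hst
      have h1 := Real.add_one_le_exp (s - t)
      have h2 : Real.exp (-t) = Real.exp (-s) * Real.exp (s - t) := by
        rw [← Real.exp_add]; ring_nf
      have h3 : Real.exp (-s) ≤ 1 := Real.exp_le_one_iff.2 (by linarith)
      have h4 : Real.exp (s - t) ≤ 1 := Real.exp_le_one_iff.2 (by linarith)
      nlinarith [Real.exp_pos (-s)]
    rw [one_mul, Real.dist_eq, Real.dist_eq]
    change |Real.exp (-K x) - Real.exp (-K y)| ≤ |K x - K y|
    rcases le_total (K x) (K y) with hle | hle
    · rw [abs_of_nonneg (by simpa using hle), abs_of_nonpos (by linarith)]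
      linarith [key _ _ (hK0 x hx) hle]
    · rw [abs_of_nonpos (by simpa using hle), abs_of_nonneg (by linarith)]
      linarith [key _ _ (hK0 y hy) hle]
  have hG := (haF.fun_mul haE).integral_deriv_eq_sub
  have hle : ∫ t in a..b, deriv (fun t => F t * Real.exp (-K t)) t ≤ 0 := by
    rw [← neg_nonneg, ← intervalIntegral.integral_neg]
    refine intervalIntegral.integral_nonneg_of_ae_restrict hab ?_
    rw [EventuallyLE, ae_restrict_iff' measurableSet_Icc]
    filter_upwards [hky.ae_hasDerivAt_integral, hk.ae_hasDerivAt_integral] with t h1 h2 ht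
    rw [← uIcc_of_le hab] at ht
    have d1 : HasDerivAt F (k t * y t) t := (h1 ht a left_mem_uIcc).const_add C
    have d2 : HasDerivAt K (k t) t := h2 ht a left_mem_uIcc
    have d3 : HasDerivAt (fun t => F t * Real.exp (-K t))
        (k t * y t * Real.exp (-K t) + F t * (Real.exp (-K t) * -k t)) t := d1.mul d2.neg.exp
    rw [d3.deriv]
    have h3 := mul_nonneg (mul_nonneg (hk0 t) (Real.exp_pos (-K t)).le) (sub_nonneg.2 (h t ht))
    simp only [Pi.zero_apply]
    change 0 ≤ k t * Real.exp (-K t) * (F t - y t) at h3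
    nlinarith
  rw [hG] at hle
  have hFa : F a = C := by simp [hF]
  have hKa : K a = 0 := by simp [hK]
  rw [hFa, hKa, neg_zero, Real.exp_zero, mul_one] at hle
  have hFb : F b ≤ C * Real.exp (K b) := by
    have : F b = F b * Real.exp (-K b) * Real.exp (K b) := by
      rw [mul_assoc, ← Real.exp_add]; simp
    rw [this]
    exact mul_le_mul_of_nonneg_right (by linarith) (Real.exp_pos _).le
  exact (h b right_mem_uIcc).trans hFb

/-- Gronwall's inequality in integral form, with an integrable kernel and in either direction of
the real line. -/
theorem le_mul_exp_of_le_add_integral {k y : ℝ → ℝ} {a b C : ℝ}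
    (hk : IntegrableOn k (uIcc a b)) (hk0 : ∀ t, 0 ≤ k t) (hy : ContinuousOn y (uIcc a b))
    (h : ∀ t ∈ uIcc a b, y t ≤ C + ∫ s in uIoc a t, k s * y s) :
    y b ≤ C * Real.exp (∫ s in uIoc a b, k s) := by
  have hk' : IntervalIntegrable k volume a b := hk.intervalIntegrable
  rcases le_total a b with hab | hab
  · rw [uIcc_of_le hab] at hy h
    rw [uIoc_of_le hab, ← intervalIntegral.integral_of_le hab]
    refine le_mul_exp_of_le_add_integral_of_le hab hk' hk0 hy fun t ht => ?_
    rw [intervalIntegral.integral_of_le ht.1, ← uIoc_of_le ht.1]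
    exact h t ht
  · rw [uIcc_of_ge hab] at hy h
    have hr := le_mul_exp_of_le_add_integral_of_le (k := fun t => k (-t)) (y := fun t => y (-t))
      (a := -a) (b := -b) (C := C) (by linarith)
      (by simpa using (hk'.comp_sub_left 0)) (fun t => hk0 _)
      (hy.comp continuous_neg.continuousOn fun t ht => ⟨by linarith [ht.2], by linarith [ht.1]⟩)
      fun t ht => by
        have h1 := h (-t) ⟨by linarith [ht.2], by linarith [ht.1]⟩
        rw [intervalIntegral.integral_comp_neg (fun s => k s * y s), neg_neg,
          intervalIntegral.integral_of_le (by linarith [ht.1]), ← uIoc_of_ge (by linarith [ht.1])]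
        exact h1
    rw [intervalIntegral.integral_comp_neg k, neg_neg, neg_neg,
      intervalIntegral.integral_of_le hab, ← uIoc_of_ge hab] at hr
    exact hr

namespace SturmLiouville

variable {T : SturmLiouville}

/-! ### Calculus of quasi-derivatives and Wronskians -/

theorem ordConnected_I : OrdConnected T.I :=
  ⟨fun _ hx _ hy _ hz => ⟨lt_of_lt_of_le hx.1 (EReal.coe_le_coe_iff.2 hz.1),
    lt_of_le_of_lt (EReal.coe_le_coe_iff.2 hz.2) hy.2⟩⟩

theorem uIcc_subset_I {c d : ℝ} (hc : c ∈ T.I) (hd : d ∈ T.I) : uIcc c d ⊆ T.I :=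
  ordConnected_I.uIcc_subset hc hd

theorem measurableSet_I : MeasurableSet T.I := T.isOpen_I.measurableSet

theorem uIoc_subset_I {c d : ℝ} (hc : c ∈ T.I) (hd : d ∈ T.I) : uIoc c d ⊆ T.I :=
  uIoc_subset_uIcc.trans (uIcc_subset_I hc hd)

theorem ae_r_pos : ∀ᵐ x : ℝ, x ∈ T.I → 0 < T.r x :=
  T.r_pos.mono fun _ h hx => h hx.1 hx.2

theorem ae_p_pos : ∀ᵐ x : ℝ, x ∈ T.I → 0 < T.p x :=
  T.p_pos.mono fun _ h hx => h hx.1 hx.2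

theorem aestronglyMeasurable_r : AEStronglyMeasurable T.r (volume.restrict T.I) :=
  LocallyIntegrableOn.aestronglyMeasurable T.r_loc

/-- A property that holds a.e. on every compact subinterval holds a.e. on `(a,b)`. -/
theorem ae_of_forall_uIcc {P : ℝ → Prop}
    (h : ∀ c ∈ T.I, ∀ d ∈ T.I, ∀ᵐ x : ℝ, x ∈ uIcc c d → P x) : ∀ᵐ x : ℝ, x ∈ T.I → P x := by
  have h' : ∀ᵐ x : ℝ, ∀ c d : ℚ, (c : ℝ) ∈ T.I → (d : ℝ) ∈ T.I → x ∈ uIcc (c : ℝ) d → P x := by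
    rw [ae_all_iff]; intro c
    rw [ae_all_iff]; intro d
    by_cases hc : (c : ℝ) ∈ T.I
    · by_cases hd : (d : ℝ) ∈ T.I
      · exact (h c hc d hd).mono fun x hx _ _ => hx
      · exact Eventually.of_forall fun x _ h => absurd h hd
    · exact Eventually.of_forall fun x h => absurd h hc
  filter_upwards [h'] with x hx hxI
  obtain ⟨e, he, hsub⟩ := Metric.isOpen_iff.1 T.isOpen_I x hxI
  obtain ⟨c, hc1, hc2⟩ := exists_rat_btwn (show x - e < x by linarith)
  obtain ⟨d, hd1, hd2⟩ := exists_rat_btwn (show x < x + e by linarith)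
  have hm : ∀ y : ℝ, x - e < y → y < x + e → y ∈ T.I := fun y h1 h2 => hsub (by
    rw [Metric.mem_ball, Real.dist_eq, abs_lt]; constructor <;> linarith)
  refine hx c d (hm _ hc1 (by linarith)) (hm _ (by linarith) hd2) ?_
  rw [uIcc_of_le (by linarith)]
  exact ⟨hc2.le, hd1.le⟩

namespace ACLoc

variable {f g : ℝ → ℂ}

theorem ae_hasDerivAt (hf : T.ACLoc f) : ∀ᵐ x : ℝ, x ∈ T.I → HasDerivAt f (deriv f x) x :=
  ae_of_forall_uIcc fun c hc d hd => (hf c hc d hd).ae_hasDerivAt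

theorem mul (hf : T.ACLoc f) (hg : T.ACLoc g) : T.ACLoc fun x => f x * g x :=
  fun c hc d hd => (hf c hc d hd).fun_smul (hg c hc d hd)

theorem add (hf : T.ACLoc f) (hg : T.ACLoc g) : T.ACLoc fun x => f x + g x :=
  fun c hc d hd => (hf c hc d hd).fun_add (hg c hc d hd)

theorem sub (hf : T.ACLoc f) (hg : T.ACLoc g) : T.ACLoc fun x => f x - g x :=
  fun c hc d hd => (hf c hc d hd).fun_sub (hg c hc d hd)

theorem integral_eq_sub {f' : ℝ → ℂ} (hf : T.ACLoc f)
    (h : ∀ᵐ x : ℝ, x ∈ T.I → HasDerivAt f (f' x) x) {c d : ℝ} (hc : c ∈ T.I) (hd : d ∈ T.I) :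
    IntervalIntegrable f' volume c d ∧ ∫ x in c..d, f' x = f d - f c :=
  (hf c hc d hd).integral_eq_sub_of_ae_hasDerivAt
    (h.mono fun _ hx hm => hx (uIcc_subset_I hc hd hm))

end ACLoc

namespace Regular

variable {f g : ℝ → ℂ}

theorem isQuasiDeriv (hf : T.Regular f) : T.IsQuasiDeriv f (T.quasiDeriv f) := by
  rw [quasiDeriv, dif_pos hf.2]
  exact hf.2.choose_spec

theorem aCLoc_quasiDeriv (hf : T.Regular f) : T.ACLoc (T.quasiDeriv f) := hf.isQuasiDeriv.1

theorem continuousOn (hf : T.Regular f) : ContinuousOn f T.I := ACLoc.continuousOn T hf.1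

theorem ae_hasDerivAt (hf : T.Regular f) :
    ∀ᵐ x : ℝ, x ∈ T.I → HasDerivAt f (T.quasiDeriv f x / T.p x) x := by
  filter_upwards [hf.1.ae_hasDerivAt, hf.isQuasiDeriv.2, T.ae_p_pos] with x h1 h2 h3 hx
  have hp : (T.p x : ℂ) ≠ 0 := by exact_mod_cast (h3 hx).ne'
  rw [h2 hx, mul_div_cancel_left₀ _ hp]
  exact h1 hx

theorem ae_hasDerivAt_quasiDeriv (hf : T.Regular f) :
    ∀ᵐ x : ℝ, x ∈ T.I → HasDerivAt (T.quasiDeriv f) (T.q x * f x - T.r x * T.tau f x) x := by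
  filter_upwards [hf.aCLoc_quasiDeriv.ae_hasDerivAt, T.ae_r_pos] with x h1 h3 hx
  have hr : (T.r x : ℂ) ≠ 0 := by exact_mod_cast (h3 hx).ne'
  have e : T.q x * f x - T.r x * T.tau f x = deriv (T.quasiDeriv f) x := by
    rw [tau]; field_simp; ring
  rw [e]
  exact h1 hx

theorem aCLoc_wronskian (hf : T.Regular f) (hg : T.Regular g) : T.ACLoc (T.wronskian f g) :=
  (hf.1.mul hg.aCLoc_quasiDeriv).sub (hf.aCLoc_quasiDeriv.mul hg.1)

theorem ae_hasDerivAt_wronskian (hf : T.Regular f) (hg : T.Regular g) :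
    ∀ᵐ x : ℝ, x ∈ T.I →
      HasDerivAt (T.wronskian f g) (T.r x * (T.tau f x * g x - f x * T.tau g x)) x := by
  filter_upwards [hf.ae_hasDerivAt, hg.ae_hasDerivAt, hf.ae_hasDerivAt_quasiDeriv,
    hg.ae_hasDerivAt_quasiDeriv] with x h1 h2 h3 h4 hx
  have h := ((h1 hx).mul (h4 hx)).sub ((h3 hx).mul (h2 hx))
  refine h.congr_deriv ?_
  ring

/-- Lagrange's identity, with the values of `τ f` and `τ g` given almost everywhere. -/
theorem integral_wronskian {F G : ℝ → ℂ} (hf : T.Regular f) (hg : T.Regular g)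
    (hF : ∀ᵐ x : ℝ, x ∈ T.I → T.tau f x = F x) (hG : ∀ᵐ x : ℝ, x ∈ T.I → T.tau g x = G x)
    {c d : ℝ} (hc : c ∈ T.I) (hd : d ∈ T.I) :
    ∫ x in c..d, T.r x * (F x * g x - f x * G x) = T.wronskian f g d - T.wronskian f g c := by
  refine ((aCLoc_wronskian hf hg).integral_eq_sub ?_ hc hd).2
  filter_upwards [hf.ae_hasDerivAt_wronskian hg, hF, hG] with x h1 h2 h3 hx
  rw [← h2 hx, ← h3 hx]
  exact h1 hx

end Regular

/-- A criterion for regularity that also identifies `f^[1]` and `τ f`. -/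
theorem regular_of_hasDerivAt {f v h : ℝ → ℂ} (hf : T.ACLoc f) (hv : T.ACLoc v)
    (hf' : ∀ᵐ x : ℝ, x ∈ T.I → HasDerivAt f (v x / T.p x) x)
    (hv' : ∀ᵐ x : ℝ, x ∈ T.I → HasDerivAt v (T.q x * f x - T.r x * h x) x) :
    T.Regular f ∧ EqOn v (T.quasiDeriv f) T.I ∧ ∀ᵐ x : ℝ, x ∈ T.I → T.tau f x = h x := by
  have hq : T.IsQuasiDeriv f v := by
    refine ⟨hv, ?_⟩
    filter_upwards [hf', T.ae_p_pos] with x h1 h2 hx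
    have hp : (T.p x : ℂ) ≠ 0 := by exact_mod_cast (h2 hx).ne'
    rw [(h1 hx).deriv, mul_div_cancel₀ _ hp]
  have he := T.eqOn_quasiDeriv hq
  refine ⟨⟨hf, v, hq⟩, he, ?_⟩
  filter_upwards [hv', T.ae_r_pos] with x h1 h2 hx
  have hr : (T.r x : ℂ) ≠ 0 := by exact_mod_cast (h2 hx).ne'
  have hd : deriv (T.quasiDeriv f) x = deriv v x :=
    (he.eventuallyEq_of_mem (T.isOpen_I.mem_nhds hx)).deriv_eq.symm
  rw [tau, hd, (h1 hx).deriv]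
  field_simp
  ring

/-! ### Variation of constants -/

variable {lam : ℝ} {w u : ℝ → ℝ}

/-- A normalized fundamental system `w, u` of real-valued solutions of `τ y = lam y`. -/
structure IsFundamentalPair (T : SturmLiouville) (lam : ℝ) (w u : ℝ → ℝ) : Prop where
  left : T.IsSolution lam (fun x => (w x : ℂ))
  right : T.IsSolution lam (fun x => (u x : ℂ))
  wronskian_eq : ∀ x ∈ T.I, T.wronskian (fun y => (w y : ℂ)) (fun y => (u y : ℂ)) x = 1

namespace IsFundamentalPair

theorem continuousOn_left (P : T.IsFundamentalPair lam w u) : ContinuousOn w T.I := by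
  exact Complex.continuous_re.comp_continuousOn P.left.1.continuousOn

theorem continuousOn_right (P : T.IsFundamentalPair lam w u) : ContinuousOn u T.I := by
  exact Complex.continuous_re.comp_continuousOn P.right.1.continuousOn

/-- The representation `g = -W(u,g) w + W(w,g) u`. -/
theorem eq_add (P : T.IsFundamentalPair lam w u) (g : ℝ → ℂ) {x : ℝ} (hx : x ∈ T.I) :
    g x = -T.wronskian (fun y => (u y : ℂ)) g x * w x +
      T.wronskian (fun y => (w y : ℂ)) g x * u x := by
  have h := P.wronskian_eq x hx
  simp only [wronskian] at h ⊢
  linear_combination (-g x) * h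

theorem wronskian_eq_coeff (P : T.IsFundamentalPair lam w u) (f g : ℝ → ℂ) {x : ℝ}
    (hx : x ∈ T.I) :
    T.wronskian f g x =
      -T.wronskian (fun y => (u y : ℂ)) f x * T.wronskian (fun y => (w y : ℂ)) g x -
      T.wronskian (fun y => (w y : ℂ)) f x * -T.wronskian (fun y => (u y : ℂ)) g x := by
  have h := P.wronskian_eq x hx
  simp only [wronskian] at h ⊢
  linear_combination (-(f x * T.quasiDeriv g x - T.quasiDeriv f x * g x)) * h

end IsFundamentalPair

/-- `A` and `B` are the coefficients obtained by variation of constants, relative to `w, u`, for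
the forcing term `φ`: they are primitives of `r u φ` and `-r w φ`. -/
structure IsVariation (T : SturmLiouville) (w u : ℝ → ℝ) (φ A B : ℝ → ℂ) : Prop where
  left : ∀ c ∈ T.I, ∀ d ∈ T.I, ∫ x in c..d, (T.r x * u x : ℂ) * φ x = A d - A c
  right : ∀ c ∈ T.I, ∀ d ∈ T.I, ∫ x in c..d, (T.r x * w x : ℂ) * φ x = -(B d - B c)

theorem IsFundamentalPair.isVariation (P : T.IsFundamentalPair lam w u) {g φ : ℝ → ℂ}
    (hg : T.Regular g) (hφ : ∀ᵐ x : ℝ, x ∈ T.I → T.tau g x = lam * g x + φ x) :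
    T.IsVariation w u φ (fun x => -T.wronskian (fun y => (u y : ℂ)) g x)
      (T.wronskian (fun y => (w y : ℂ)) g) := by
  constructor
  · intro c hc d hd
    have h := P.right.1.integral_wronskian hg P.right.2 hφ hc hd
    rw [neg_sub_neg, ← neg_sub, ← h, ← intervalIntegral.integral_neg]
    exact intervalIntegral.integral_congr fun x _ => by ring
  · intro c hc d hd
    have h := P.left.1.integral_wronskian hg P.left.2 hφ hc hd
    rw [← h, ← intervalIntegral.integral_neg]
    exact intervalIntegral.integral_congr fun x _ => by ring

/-- Conversely, `g = A w + B u` solves `τ g = lam g + φ`. -/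
theorem IsFundamentalPair.regular_of_isVariation (P : T.IsFundamentalPair lam w u)
    {φ A B g : ℝ → ℂ} (hV : T.IsVariation w u φ A B)
    (hu : ∀ c ∈ T.I, ∀ d ∈ T.I, IntervalIntegrable (fun x => (T.r x * u x : ℂ) * φ x) volume c d)
    (hw : ∀ c ∈ T.I, ∀ d ∈ T.I, IntervalIntegrable (fun x => (T.r x * w x : ℂ) * φ x) volume c d)
    (hg : ∀ x ∈ T.I, g x = A x * w x + B x * u x) :
    T.Regular g ∧ ∀ᵐ x : ℝ, x ∈ T.I → T.tau g x = lam * g x + φ x := by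
  have hAC : T.ACLoc A := fun c hc d hd => by
    refine ((hu c hc d hd).absolutelyContinuousOnInterval_complex left_mem_uIcc).of_dist_le
      (K := 1) fun x hx y hy => ?_
    rw [hV.left c hc x (uIcc_subset_I hc hd hx), hV.left c hc y (uIcc_subset_I hc hd hy)]
    simp
  have hBC : T.ACLoc B := fun c hc d hd => by
    refine ((hw c hc d hd).absolutelyContinuousOnInterval_complex left_mem_uIcc).of_dist_le
      (K := 1) fun x hx y hy => ?_
    rw [hV.right c hc x (uIcc_subset_I hc hd hx), hV.right c hc y (uIcc_subset_I hc hd hy),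
      dist_neg_neg, dist_sub_right, one_mul]
  have hA' : ∀ᵐ x : ℝ, x ∈ T.I → HasDerivAt A ((T.r x * u x : ℂ) * φ x) x := by
    refine ae_of_forall_uIcc fun c hc d hd => ?_
    filter_upwards [(hu c hc d hd).ae_hasDerivAt_integral] with x hx hm
    have h := (hx hm c left_mem_uIcc).add_const (A c)
    refine h.congr_of_eventuallyEq ?_
    filter_upwards [T.isOpen_I.mem_nhds (uIcc_subset_I hc hd hm)] with y hy
    rw [hV.left c hc y hy]; ring
  have hB' : ∀ᵐ x : ℝ, x ∈ T.I → HasDerivAt B (-((T.r x * w x : ℂ) * φ x)) x := by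
    refine ae_of_forall_uIcc fun c hc d hd => ?_
    filter_upwards [(hw c hc d hd).ae_hasDerivAt_integral] with x hx hm
    have h := ((hx hm c left_mem_uIcc).neg).add_const (B c)
    refine h.congr_of_eventuallyEq ?_
    filter_upwards [T.isOpen_I.mem_nhds (uIcc_subset_I hc hd hm)] with y hy
    rw [Pi.neg_apply, hV.right c hc y hy]; ring
  have hgAC : T.ACLoc g := fun c hc d hd =>
    (((hAC.mul P.left.1.1).add (hBC.mul P.right.1.1)) c hc d hd).congr
      fun x hx => (hg x (uIcc_subset_I hc hd hx)).symm
  have key := regular_of_hasDerivAt (T := T) (f := g)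
    (v := fun x => A x * T.quasiDeriv (fun y => (w y : ℂ)) x +
      B x * T.quasiDeriv (fun y => (u y : ℂ)) x) (h := fun x => lam * g x + φ x) hgAC
    ((hAC.mul P.left.1.aCLoc_quasiDeriv).add (hBC.mul P.right.1.aCLoc_quasiDeriv)) ?_ ?_
  · exact ⟨key.1, key.2.2⟩
  · filter_upwards [hA', hB', P.left.1.ae_hasDerivAt, P.right.1.ae_hasDerivAt]
      with x h1 h2 h3 h4 hx
    have h := ((h1 hx).mul (h3 hx)).add ((h2 hx).mul (h4 hx))
    refine (h.congr_of_eventuallyEq ?_).congr_deriv ?_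
    · filter_upwards [T.isOpen_I.mem_nhds hx] with y hy
      exact hg y hy
    · ring
  · filter_upwards [hA', hB', P.left.1.ae_hasDerivAt_quasiDeriv,
      P.right.1.ae_hasDerivAt_quasiDeriv, P.left.2, P.right.2] with x h1 h2 h3 h4 h5 h6 hx
    have h := ((h1 hx).mul (h3 hx)).add ((h2 hx).mul (h4 hx))
    refine h.congr_deriv ?_
    have hW := P.wronskian_eq x hx
    rw [wronskian] at hW
    rw [h5 hx, h6 hx, hg x hx]
    linear_combination (-T.r x * φ x) * hW

/-! ### Square integrability of solutions -/

/-- In the quasi-regular case all solutions are square integrable on the whole interval. -/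
theorem QuasiRegular.integrableOn (hT : T.QuasiRegular) {z : ℂ} {f : ℝ → ℂ}
    (hf : T.IsSolution z f) : IntegrableOn (fun x => T.r x * ‖f x‖ ^ 2) T.I := by
  obtain ⟨c, hc, hcl⟩ := hT.1 z f hf
  obtain ⟨d, hd, hdr⟩ := hT.2 z f hf
  have hm : IntegrableOn (fun x => T.r x * ‖f x‖ ^ 2) (uIcc c d) :=
    (T.r_loc.integrableOn_compact_subset (uIcc_subset_I hc hd) isCompact_uIcc).mul_continuousOn
      ((hf.1.continuousOn.mono (uIcc_subset_I hc hd)).norm.pow 2) isCompact_uIcc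
  refine ((hcl.union hm).union hdr).mono_set fun x hx => ?_
  rcases lt_or_ge x c with h | h
  · exact Or.inl (Or.inl ⟨hx, h⟩)
  · rcases lt_or_ge d x with h' | h'
    · exact Or.inr ⟨hx, h'⟩
    · exact Or.inl (Or.inr (Icc_subset_uIcc ⟨h, h'⟩))

/-- The product of two functions in `L²(r dx)` is integrable with respect to `r dx`. -/
theorem integrableOn_mul {f g : ℝ → ℂ} (hf : AEStronglyMeasurable f (volume.restrict T.I))
    (hg : AEStronglyMeasurable g (volume.restrict T.I))
    (hf2 : IntegrableOn (fun x => T.r x * ‖f x‖ ^ 2) T.I)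
    (hg2 : IntegrableOn (fun x => T.r x * ‖g x‖ ^ 2) T.I) :
    IntegrableOn (fun x => (T.r x * f x : ℂ) * g x) T.I := by
  have hr : AEStronglyMeasurable (fun x => (T.r x : ℂ)) (volume.restrict T.I) :=
    Complex.continuous_ofReal.comp_aestronglyMeasurable T.aestronglyMeasurable_r
  refine Integrable.mono' (hf2.add hg2) ((hr.mul hf).mul hg) ?_
  rw [ae_restrict_iff' T.measurableSet_I]
  filter_upwards [T.ae_r_pos] with x h hx
  have h0 := h hx
  rw [norm_mul, norm_mul, Complex.norm_real, Real.norm_of_nonneg h0.le, Pi.add_apply]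
  nlinarith [mul_nonneg h0.le (sq_nonneg (‖f x‖ - ‖g x‖)),
    mul_nonneg h0.le (mul_nonneg (norm_nonneg (f x)) (norm_nonneg (g x)))]

/-- The weight `|r| (|u| + |w|)²` that controls the coefficients in variation of constants. -/
noncomputable def weight (T : SturmLiouville) (w u : ℝ → ℝ) (x : ℝ) : ℝ :=
  |T.r x| * (|u x| + |w x|) ^ 2

theorem weight_nonneg (x : ℝ) : 0 ≤ T.weight w u x := by
  unfold weight; positivity

theorem IsFundamentalPair.integrableOn_weight (P : T.IsFundamentalPair lam w u)
    (hT : T.QuasiRegular) : IntegrableOn (T.weight w u) T.I := by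
  have h1 := hT.integrableOn P.left
  have h2 := hT.integrableOn P.right
  have hm : AEStronglyMeasurable (T.weight w u) (volume.restrict T.I) :=
    (continuous_abs.comp_aestronglyMeasurable T.aestronglyMeasurable_r).mul
      (((P.continuousOn_right.abs.add P.continuousOn_left.abs).pow 2).aestronglyMeasurable
        T.measurableSet_I)
  refine Integrable.mono' ((h1.add h2).const_mul 2) hm ?_
  rw [ae_restrict_iff' T.measurableSet_I]
  filter_upwards [T.ae_r_pos] with x h hx
  have h0 := h hx
  rw [Real.norm_of_nonneg (weight_nonneg x), weight, abs_of_pos h0, Pi.add_apply]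
  simp only [Complex.norm_real, Real.norm_eq_abs]
  nlinarith [mul_nonneg h0.le (sq_nonneg (|u x| - |w x|))]

/-! ### Limits at an endpoint -/

/-- The filter `l` describes the approach to one of the two endpoints of `(a,b)`, and `S x` is the
part of `(a,b)` between `x` (included) and that endpoint. It allows both endpoints to be treated
at once. -/
structure IsEndpoint (T : SturmLiouville) (l : Filter ℝ) (S : ℝ → Set ℝ) : Prop where
  neBot : l.NeBot
  isCountablyGenerated : l.IsCountablyGenerated
  subset : ∀ x, S x ⊆ T.I
  measurableSet : ∀ x, MeasurableSet (S x)
  eventually_mem : ∀ x ∈ T.I, ∀ᶠ y in l, y ∈ S x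
  eventually_notMem : ∀ t ∈ T.I, ∀ᶠ x in l, t ∉ S x
  uIcc_subset : ∀ x ∈ T.I, ∀ y ∈ S x, uIcc x y ⊆ S x
  eventually_mem_uIcc : ∀ c ∈ T.I, ∀ t ∈ S c, ∀ᶠ x in l, t ∈ uIcc c x
  trans : ∀ c x t, x ∈ S c → t ∈ S x → t ∈ S c
  sign : (∀ x ∈ T.I, ∀ y ∈ S x, x ≤ y) ∨ (∀ x ∈ T.I, ∀ y ∈ S x, y ≤ x)

theorem nonempty_I : T.I.Nonempty := by
  obtain ⟨q, h1, h2⟩ := EReal.exists_rat_btwn_of_lt T.a_lt_b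
  exact ⟨(q : ℝ), h1, h2⟩

theorem isEndpoint_atRight : T.IsEndpoint T.atRight (fun x => {t | t ∈ T.I ∧ x ≤ t}) where
  neBot := by
    refine comap_neBot fun s hs => ?_
    obtain ⟨e, he, hsub⟩ := (mem_nhdsLT_iff_exists_Ioo_subset' T.a_lt_b).1 hs
    obtain ⟨q, h1, h2⟩ := EReal.exists_rat_btwn_of_lt he
    exact ⟨(q : ℝ), hsub ⟨h1, h2⟩⟩
  isCountablyGenerated := by unfold atRight; infer_instance
  subset := fun x t ht => ht.1
  measurableSet := fun x => measurableSet_I.inter measurableSet_Ici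
  eventually_mem := fun x hx => by
    refine ⟨Ioo (x : EReal) T.b, Ioo_mem_nhdsLT hx.2, fun t ht => ?_⟩
    have h : x < t := EReal.coe_lt_coe_iff.1 ht.1
    exact ⟨⟨hx.1.trans ht.1, ht.2⟩, h.le⟩
  eventually_notMem := fun t ht => by
    refine ⟨Ioo (t : EReal) T.b, Ioo_mem_nhdsLT ht.2, fun x hx h => ?_⟩
    exact absurd h.2 (not_le.2 (EReal.coe_lt_coe_iff.1 hx.1))
  uIcc_subset := fun x hx y hy t ht => by
    have ht' := uIcc_subset_I hx hy.1 ht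
    rw [uIcc_of_le hy.2] at ht
    exact ⟨ht', ht.1⟩
  eventually_mem_uIcc := fun c hc t ht => by
    refine ⟨Ioo (t : EReal) T.b, Ioo_mem_nhdsLT ht.1.2, fun x hx => ?_⟩
    exact Icc_subset_uIcc ⟨ht.2, (EReal.coe_lt_coe_iff.1 hx.1).le⟩
  trans := fun c x t hx ht => ⟨ht.1, hx.2.trans ht.2⟩
  sign := Or.inl fun x _ y hy => hy.2

theorem isEndpoint_atLeft : T.IsEndpoint T.atLeft (fun x => {t | t ∈ T.I ∧ t ≤ x}) where
  neBot := by
    refine comap_neBot fun s hs => ?_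
    obtain ⟨e, he, hsub⟩ := (mem_nhdsGT_iff_exists_Ioo_subset' T.a_lt_b).1 hs
    obtain ⟨q, h1, h2⟩ := EReal.exists_rat_btwn_of_lt he
    exact ⟨(q : ℝ), hsub ⟨h1, h2⟩⟩
  isCountablyGenerated := by unfold atLeft; infer_instance
  subset := fun x t ht => ht.1
  measurableSet := fun x => measurableSet_I.inter measurableSet_Iic
  eventually_mem := fun x hx => by
    refine ⟨Ioo T.a (x : EReal), Ioo_mem_nhdsGT hx.1, fun t ht => ?_⟩
    have h : t < x := EReal.coe_lt_coe_iff.1 ht.2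
    exact ⟨⟨ht.1, ht.2.trans hx.2⟩, h.le⟩
  eventually_notMem := fun t ht => by
    refine ⟨Ioo T.a (t : EReal), Ioo_mem_nhdsGT ht.1, fun x hx h => ?_⟩
    exact absurd h.2 (not_le.2 (EReal.coe_lt_coe_iff.1 hx.2))
  uIcc_subset := fun x hx y hy t ht => by
    have ht' := uIcc_subset_I hx hy.1 ht
    rw [uIcc_of_ge hy.2] at ht
    exact ⟨ht', ht.2⟩
  eventually_mem_uIcc := fun c hc t ht => by
    refine ⟨Ioo T.a (t : EReal), Ioo_mem_nhdsGT ht.1.1, fun x hx => ?_⟩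
    exact Icc_subset_uIcc' ⟨(EReal.coe_lt_coe_iff.1 hx.2).le, ht.2⟩
  trans := fun c x t hx ht => ⟨ht.1, ht.2.trans hx.2⟩
  sign := Or.inr fun x _ y hy => hy.2

namespace IsEndpoint

variable {l : Filter ℝ} {S : ℝ → Set ℝ}

theorem eventually_mem_I (hE : T.IsEndpoint l S) : ∀ᶠ x in l, x ∈ T.I :=
  let ⟨c, hc⟩ := T.nonempty_I
  (hE.eventually_mem c hc).mono fun _ h => hE.subset c h

theorem tendsto_tail (hE : T.IsEndpoint l S) {ψ : ℝ → ℝ} (hψ : IntegrableOn ψ T.I) :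
    Tendsto (fun x => ∫ t in S x, ψ t) l (𝓝 0) := by
  have := hE.isCountablyGenerated
  have h : Tendsto (fun x => ∫ t in T.I, (S x).indicator ψ t) l (𝓝 (∫ t in T.I, (0 : ℝ))) := by
    refine tendsto_integral_filter_of_dominated_convergence (fun t => ‖ψ t‖)
      (Eventually.of_forall fun x => hψ.aestronglyMeasurable.indicator (hE.measurableSet x))
      (Eventually.of_forall fun x => Eventually.of_forall fun t => norm_indicator_le_norm_self _ _)
      hψ.norm ?_
    rw [ae_restrict_iff' T.measurableSet_I]
    refine Eventually.of_forall fun t ht => tendsto_const_nhds.congr' ?_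
    filter_upwards [hE.eventually_notMem t ht] with x hx
    rw [indicator_of_notMem hx]
  rw [integral_zero] at h
  refine h.congr fun x => ?_
  rw [setIntegral_indicator (hE.measurableSet x), inter_eq_right.2 (hE.subset x)]

/-- The primitive of an integrable function has a limit at each endpoint, and it approaches its
limit at least as fast as the tail of the integral vanishes. -/
theorem exists_tendsto_primitive (hE : T.IsEndpoint l S) {G φ : ℝ → ℂ}
    (hφ : IntegrableOn φ T.I) (hG : ∀ c ∈ T.I, ∀ d ∈ T.I, ‖G d - G c‖ ≤ ‖∫ x in c..d, φ x‖) :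
    ∃ L, Tendsto G l (𝓝 L) ∧ ∀ x ∈ T.I, ‖G x - L‖ ≤ ∫ t in S x, ‖φ t‖ := by
  have := hE.neBot
  have hle : ∀ x ∈ T.I, ∀ y ∈ S x, ‖G y - G x‖ ≤ ∫ t in S x, ‖φ t‖ := fun x hx y hy => by
    refine (hG x hx y (hE.subset x hy)).trans
      (intervalIntegral.norm_integral_le_integral_norm_uIoc.trans ?_)
    exact setIntegral_mono_set (IntegrableOn.mono_set hφ.norm (hE.subset x))
      (Eventually.of_forall fun _ => norm_nonneg _)
      (uIoc_subset_uIcc.trans (hE.uIcc_subset x hx y hy)).eventuallyLE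
  have hC : Cauchy (map G l) := by
    refine Metric.cauchy_iff.2 ⟨inferInstance, fun ε hε => ?_⟩
    obtain ⟨x, hx, hxI⟩ := (((hE.tendsto_tail hφ.norm).eventually_lt_const
      (half_pos hε)).and hE.eventually_mem_I).exists
    refine ⟨G '' S x, image_mem_map (hE.eventually_mem x hxI), ?_⟩
    rintro _ ⟨y, hy, rfl⟩ _ ⟨y', hy', rfl⟩
    have h1 := hle x hxI y hy
    have h2 := hle x hxI y' hy'
    rw [← dist_eq_norm] at h1 h2
    linarith [dist_triangle_right (G y) (G y') (G x)]
  obtain ⟨L, hL⟩ := cauchy_map_iff_exists_tendsto.1 hC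
  refine ⟨L, hL, fun x hx => ?_⟩
  rw [norm_sub_rev]
  refine le_of_tendsto (hL.sub_const (G x)).norm ?_
  filter_upwards [hE.eventually_mem x hx] with y hy using hle x hx y hy

/-- If `u` is principal, the quotient `w / u` is monotone near the endpoint and unbounded there,
because `(w / u)' = -W(w, u) / (p u²)` and the integral of `1 / (p u²)` diverges. -/
theorem abs_div_principal (hE : T.IsEndpoint l S) (P : T.IsFundamentalPair lam w u) {c : ℝ}
    (hc : c ∈ T.I) (hu : ∀ x ∈ S c, u x ≠ 0)
    (hint : ∫⁻ x in S c, ENNReal.ofReal (1 / (T.p x * u x ^ 2)) = ⊤) :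
    (∀ᶠ x in l, ∀ t ∈ S x, |w x / u x| ≤ |w t / u t|) ∧
      Tendsto (fun x => |w x / u x|) l atTop := by
  have := hE.neBot
  have := hE.isCountablyGenerated
  set κ : ℝ → ℝ := fun x => 1 / (T.p x * u x ^ 2) with hκ
  have hκ0 : ∀ᵐ x : ℝ, x ∈ T.I → 0 ≤ κ x := by
    filter_upwards [T.ae_p_pos] with x h hx
    have := h hx
    positivity
  have hκ0' : ∀ s ⊆ T.I, MeasurableSet s → 0 ≤ᵐ[volume.restrict s] κ := fun s hs hm => by
    rw [EventuallyLE, ae_restrict_iff' hm]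
    filter_upwards [hκ0] with x h hx using h (hs hx)
  -- the quotient is a primitive of `-1 / (p u²)`
  have hFTC : ∀ x ∈ S c, IntegrableOn κ (uIoc c x) ∧
      ∫ t in c..x, κ t = w c / u c - w x / u x := by
    intro x hx
    have hxI := hE.subset c hx
    have hsub := uIcc_subset_I hc hxI
    have hne : ∀ t ∈ uIcc c x, (u t : ℂ) ≠ 0 := fun t ht => by
      exact_mod_cast hu t (hE.uIcc_subset c hc x hx ht)
    obtain ⟨M, hM⟩ := isCompact_uIcc.exists_bound_of_continuousOn
      ((P.right.1.continuousOn.mono hsub).inv₀ hne)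
    have hM0 : 0 ≤ M := (norm_nonneg _).trans (hM c left_mem_uIcc)
    have hinv : AbsolutelyContinuousOnInterval (fun t => (u t : ℂ)⁻¹) c x := by
      refine (P.right.1.1 c hc x hxI).of_dist_le (K := M * M) fun s hs t ht => ?_
      rw [dist_inv_inv₀ (hne s hs) (hne t ht), div_eq_mul_inv, mul_inv, ← norm_inv, ← norm_inv,
        mul_comm]
      exact mul_le_mul_of_nonneg_right
        (mul_le_mul (hM s hs) (hM t ht) (norm_nonneg _) hM0) dist_nonneg
    have hquot := (P.left.1.1 c hc x hxI).fun_smul hinv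
    have key := hquot.integral_eq_sub_of_ae_hasDerivAt (f' := fun t => ((-κ t : ℝ) : ℂ)) ?_
    · have hi : IntervalIntegrable (fun t => -κ t) volume c x := by
        have := key.1
        exact ⟨by simpa using! this.1.re, by simpa using! this.2.re⟩
      have hi' := hi.neg
      simp only [Pi.neg_def, neg_neg] at hi'
      refine ⟨intervalIntegrable_iff.1 hi', ?_⟩
      have h := key.2
      rw [intervalIntegral.integral_ofReal, intervalIntegral.integral_neg] at h
      simp only [smul_eq_mul, ← div_eq_mul_inv] at h
      have h' : -∫ t in c..x, κ t = w x / u x - w c / u c := by exact_mod_cast h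
      linarith
    · filter_upwards [P.left.1.ae_hasDerivAt, P.right.1.ae_hasDerivAt, T.ae_p_pos]
        with t h1 h2 h3 ht
      have htI := hsub ht
      have hp : (T.p t : ℂ) ≠ 0 := by exact_mod_cast (h3 htI).ne'
      have hut := hne t ht
      have hW := P.wronskian_eq t htI
      rw [wronskian] at hW
      have h := (h1 htI).mul ((h2 htI).inv hut)
      refine h.congr_deriv ?_
      simp only [hκ]
      push_cast
      simp only [Pi.inv_apply]
      field_simp
      linear_combination -hW
  -- its variation between `c` and the endpoint is infinite
  have hN : Tendsto (fun x => ∫ t in uIoc c x, κ t) l atTop := by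
    rw [← ENNReal.tendsto_ofReal_nhds_top]
    have hcov : AECover (volume.restrict (S c)) l (fun x => uIcc c x) := by
      refine ⟨?_, fun x => measurableSet_uIcc⟩
      rw [ae_restrict_iff' (hE.measurableSet c)]
      exact Eventually.of_forall fun t ht => hE.eventually_mem_uIcc c hc t ht
    have hmeas : AEMeasurable (fun x => ENNReal.ofReal (κ x)) (volume.restrict (S c)) := by
      have hp : AEMeasurable (fun x => 1 / T.p x) (volume.restrict T.I) :=
        (LocallyIntegrableOn.aestronglyMeasurable T.p_inv_loc).aemeasurable
      have hu' : AEMeasurable u (volume.restrict T.I) :=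
        (P.continuousOn_right.aestronglyMeasurable T.measurableSet_I).aemeasurable
      have : AEMeasurable κ (volume.restrict T.I) := by
        refine (hp.mul (hu'.pow_const 2).inv).congr (Eventually.of_forall fun x => ?_)
        simp [hκ, mul_comm]
      exact (this.mono_measure (Measure.restrict_mono (hE.subset c) le_rfl)).ennreal_ofReal
    have h := hcov.lintegral_tendsto_of_countably_generated hmeas
    rw [hint] at h
    refine h.congr' ?_
    filter_upwards [hE.eventually_mem c hc] with x hx
    have hxs := hE.uIcc_subset c hc x hx
    rw [Measure.restrict_restrict measurableSet_uIcc, inter_eq_left.2 hxs,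
      ofReal_integral_eq_lintegral_ofReal (hFTC x hx).1
        (hκ0' _ ((uIoc_subset_uIcc.trans hxs).trans (hE.subset c)) measurableSet_uIoc)]
    refine setLIntegral_congr ?_
    exact Ioc_ae_eq_Icc.symm
  -- the sign of `ε` is the direction in which the endpoint is approached
  obtain ⟨ε, hε, hNε⟩ : ∃ ε : ℝ, |ε| = 1 ∧ ∀ x ∈ S c,
      ∫ t in uIoc c x, κ t = ε * (w c / u c - w x / u x) := by
    rcases hE.sign with hs | hs
    · refine ⟨1, by simp, fun x hx => ?_⟩
      rw [← (hFTC x hx).2, intervalIntegral.integral_of_le (hs c hc x hx),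
        uIoc_of_le (hs c hc x hx), one_mul]
    · refine ⟨-1, by simp, fun x hx => ?_⟩
      rw [← (hFTC x hx).2, intervalIntegral.integral_of_ge (hs c hc x hx),
        uIoc_of_ge (hs c hc x hx), neg_one_mul, neg_neg]
  have habs : ∀ x, |w x / u x| = |ε * (w x / u x)| := fun x => by rw [abs_mul, hε, one_mul]
  have hge : ∀ x ∈ S c, (∫ t in uIoc c x, κ t) - ε * (w c / u c) ≤ |w x / u x| := fun x hx => by
    rw [habs, hNε x hx]
    linarith [neg_abs_le (ε * (w x / u x))]
  refine ⟨?_, tendsto_atTop_mono' l ?_ (tendsto_atTop_add_const_right l (-(ε * (w c / u c))) hN)⟩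
  · filter_upwards [hE.eventually_mem c hc, hN.eventually_ge_atTop (ε * (w c / u c))]
      with x hx hNx t ht
    have hxI := hE.subset c hx
    have htI := hE.subset x ht
    have htc := hE.trans c x t hx ht
    have hmem : x ∈ uIcc c t := by
      rcases hE.sign with hs | hs
      · exact Icc_subset_uIcc ⟨hs c hc x hx, hs x hxI t ht⟩
      · exact Icc_subset_uIcc' ⟨hs x hxI t ht, hs c hc x hx⟩
    have e : |w x / u x| = (∫ t in uIoc c x, κ t) - ε * (w c / u c) := by
      rw [habs, hNε x hx, abs_of_nonpos (by rw [hNε x hx] at hNx; linarith)]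
      ring
    rw [e]
    refine le_trans ?_ (hge t htc)
    refine sub_le_sub_right (setIntegral_mono_set (hFTC t htc).1
      (hκ0' _ (uIoc_subset_I hc htI) measurableSet_uIoc) ?_) _
    exact (uIoc_subset_uIoc_of_uIcc_subset_uIcc (uIcc_subset_uIcc_left hmem)).eventuallyLE
  · filter_upwards [hE.eventually_mem c hc] with x hx
    have := hge x hx
    linarith

/-- In terms of the coefficients `A = -W(u,g)`, `B = W(w,g)` of `g = A w + B u`, both boundary
values exist as soon as `τ g - lam g` is integrable against `u` and `w`. The tail of the integral
for `A` is multiplied by `w / u`, which by monotonicity can be moved under the integral. -/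
theorem hasBdryValues (hE : T.IsEndpoint l S) (P : T.IsFundamentalPair lam w u) {c : ℝ}
    (hc : c ∈ T.I) (hu : ∀ x ∈ S c, u x ≠ 0)
    (hint : ∫⁻ x in S c, ENNReal.ofReal (1 / (T.p x * u x ^ 2)) = ⊤) {g φ : ℝ → ℂ}
    (hg : T.Regular g) (hφ : ∀ᵐ x : ℝ, x ∈ T.I → T.tau g x = lam * g x + φ x)
    (hiu : IntegrableOn (fun x => (T.r x * u x : ℂ) * φ x) T.I)
    (hiw : IntegrableOn (fun x => (T.r x * w x : ℂ) * φ x) T.I) :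
    T.HasBdryValues l w u g := by
  have := hE.neBot
  obtain ⟨hmono, htop⟩ := hE.abs_div_principal P hc hu hint
  have hV := P.isVariation hg hφ
  obtain ⟨LA, hA, hAle⟩ := hE.exists_tendsto_primitive hiu
    fun c hc d hd => (congrArg norm (hV.left c hc d hd)).ge
  obtain ⟨LB, hB, -⟩ := hE.exists_tendsto_primitive hiw
    fun c hc d hd => by rw [hV.right c hc d hd, norm_neg]
  have eA : T.bdryVal l u g = LA := hA.limUnder_eq
  have eB : T.bdryDeriv l w g = LB := hB.limUnder_eq
  refine ⟨by rwa [eA], by rwa [eB], ?_, ?_⟩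
  · have h0 : Tendsto (fun x => (u x : ℂ) / w x) l (𝓝 0) := by
      rw [tendsto_zero_iff_norm_tendsto_zero]
      refine htop.inv_tendsto_atTop.congr fun x => ?_
      rw [Pi.inv_apply, ← Complex.ofReal_div, Complex.norm_real, Real.norm_eq_abs, ← abs_inv,
        inv_div]
    have h := hA.add (hB.mul h0)
    rw [mul_zero, add_zero] at h
    rw [eA]
    refine h.congr' ?_
    filter_upwards [hE.eventually_mem_I, htop.eventually_gt_atTop 0] with x hx hpos
    have hw : (w x : ℂ) ≠ 0 := by
      intro h0
      rw [Complex.ofReal_eq_zero] at h0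
      simp [h0] at hpos
    conv_rhs => rw [P.eq_add g hx]
    field_simp
  · have h0 : Tendsto (fun x => (-T.wronskian (fun y => (u y : ℂ)) g x - LA) * (w x / u x : ℂ)) l
        (𝓝 0) := by
      refine squeeze_zero_norm' ?_ (hE.tendsto_tail hiw.norm)
      filter_upwards [hE.eventually_mem_I, hmono, hE.eventually_mem c hc] with x hx hm hxc
      rw [norm_mul, mul_comm, ← Complex.ofReal_div, Complex.norm_real, Real.norm_eq_abs]
      refine (mul_le_mul_of_nonneg_left (hAle x hx) (abs_nonneg _)).trans ?_
      rw [← integral_const_mul]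
      refine setIntegral_mono_on ((IntegrableOn.mono_set hiu.norm (hE.subset x)).const_mul _)
        (IntegrableOn.mono_set hiw.norm (hE.subset x)) (hE.measurableSet x) fun t ht => ?_
      have htu : u t ≠ 0 := hu t (hE.trans c x t hxc ht)
      have h1 : |w t| = |w t / u t| * |u t| := by rw [← abs_mul, div_mul_cancel₀ _ htu]
      simp only [norm_mul, Complex.norm_real, Real.norm_eq_abs]
      rw [h1]
      have h2 : 0 ≤ |T.r t| * |u t| * ‖φ t‖ := by positivity
      nlinarith [mul_le_mul_of_nonneg_right (hm t ht) h2]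
    have h := hB.add h0
    rw [add_zero] at h
    rw [eA, eB]
    refine h.congr' ?_
    filter_upwards [hE.eventually_mem c hc] with x hx
    have hux : (u x : ℂ) ≠ 0 := by exact_mod_cast hu x hx
    conv_rhs => rw [P.eq_add g (hE.subset c hx)]
    field_simp
    ring

end IsEndpoint

end SturmLiouville

/-! ### Uniform bounds from pointwise bounds -/

/-- By Baire's theorem, a pointwise bounded sequence of continuous functions is uniformly bounded
on some nondegenerate interval. -/
theorem exists_Icc_forall_le_of_pointwise_bounded {U : Set ℝ} (hU : IsOpen U) (hne : U.Nonempty)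
    {F : ℕ → ℝ → ℝ} (hF : ∀ n, ContinuousOn (F n) U) (hb : ∀ x ∈ U, ∃ M, ∀ n, F n x ≤ M) :
    ∃ c d, c < d ∧ Icc c d ⊆ U ∧ ∃ M : ℝ, ∀ n, ∀ x ∈ Icc c d, F n x ≤ M := by
  have : LocallyCompactSpace U := hU.locallyCompactSpace
  have : Nonempty U := hne.to_subtype
  have hclosed : ∀ m : ℕ, IsClosed {x : U | ∀ n, F n x ≤ m} := fun m => by
    rw [ofPred_forall]
    exact isClosed_iInter fun n => isClosed_le (hF n).domRestrict continuous_const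
  have hcover : ⋃ m : ℕ, {x : U | ∀ n, F n x ≤ m} = univ := by
    refine eq_univ_of_forall fun x => mem_iUnion.2 ?_
    obtain ⟨M, hM⟩ := hb x x.2
    obtain ⟨m, hm⟩ := exists_nat_ge M
    exact ⟨m, fun n => (hM n).trans hm⟩
  obtain ⟨m, x, hx⟩ := nonempty_interior_of_iUnion_of_closed hclosed hcover
  have hopen : IsOpen (Subtype.val '' interior {x : U | ∀ n, F n x ≤ m}) :=
    hU.isOpenMap_subtype_val _ isOpen_interior
  obtain ⟨e, he, hsub⟩ := Metric.isOpen_iff.1 hopen x (mem_image_of_mem _ hx)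
  have hsub' : ∀ y ∈ Icc (x : ℝ) (x + e / 2), ∃ hy : y ∈ U, ∀ n, F n y ≤ m := fun y hy => by
    obtain ⟨y', hy', rfl⟩ := hsub (show y ∈ Metric.ball (x : ℝ) e by
      rw [Metric.mem_ball, Real.dist_eq, abs_of_nonneg (by linarith [hy.1])]
      linarith [hy.2])
    exact ⟨y'.2, interior_subset hy'⟩
  exact ⟨x, x + e / 2, by linarith, fun y hy => (hsub' y hy).1, m,
    fun n y hy => (hsub' y hy).2 n⟩

namespace SturmLiouville

variable {T : SturmLiouville} {lam : ℝ} {w u : ℝ → ℝ}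

theorem intervalIntegrable_mul {v : ℝ → ℝ} {φ : ℝ → ℂ} (hv : ContinuousOn v T.I)
    (hφ : ContinuousOn φ T.I) {c d : ℝ} (hc : c ∈ T.I) (hd : d ∈ T.I) :
    IntervalIntegrable (fun x => (T.r x * v x : ℂ) * φ x) volume c d := by
  have hsub := uIcc_subset_I hc hd
  have hr : IntegrableOn T.r (uIcc c d) :=
    T.r_loc.integrableOn_compact_subset hsub isCompact_uIcc
  have h : IntegrableOn (fun x => (T.r x : ℂ) * ((v x : ℂ) * φ x)) (uIcc c d) :=
    IntegrableOn.mul_continuousOn (Integrable.ofReal hr)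
      (((Complex.continuous_ofReal.comp_continuousOn hv).mul hφ).mono hsub) isCompact_uIcc
  simp only [mul_assoc]
  exact h.intervalIntegrable

theorem tendsto_intervalIntegral_mul {v b : ℝ → ℝ} {ψ : ℕ → ℝ → ℂ} {ψ₀ : ℝ → ℂ}
    (hv : ContinuousOn v T.I) (hb : ContinuousOn b T.I) (hψ : ∀ n, ContinuousOn (ψ n) T.I)
    (hlim : ∀ x ∈ T.I, Tendsto (fun n => ψ n x) atTop (𝓝 (ψ₀ x))) {c d : ℝ} (hc : c ∈ T.I)
    (hd : d ∈ T.I) (hle : ∀ n, ∀ x ∈ uIoc c d, ‖ψ n x‖ ≤ b x) :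
    Tendsto (fun n => ∫ x in c..d, (T.r x * v x : ℂ) * ψ n x) atTop
      (𝓝 (∫ x in c..d, (T.r x * v x : ℂ) * ψ₀ x)) := by
  refine intervalIntegral.tendsto_integral_filter_of_dominated_convergence
    (fun x => |T.r x| * (|v x| * b x))
    (Eventually.of_forall fun n => ?_) (Eventually.of_forall fun n => Eventually.of_forall
      fun x hx => ?_) ?_ (Eventually.of_forall fun x hx => ?_)
  · exact (intervalIntegrable_iff.1 (intervalIntegrable_mul hv (hψ n) hc hd)).aestronglyMeasurable
  · rw [norm_mul, norm_mul, Complex.norm_real, Complex.norm_real, Real.norm_eq_abs,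
      Real.norm_eq_abs, mul_assoc]
    have := hle n x hx
    gcongr
  · have hsub := uIcc_subset_I hc hd
    have hr : IntegrableOn (fun x => |T.r x|) (uIcc c d) :=
      Integrable.abs (T.r_loc.integrableOn_compact_subset hsub isCompact_uIcc)
    exact (hr.mul_continuousOn ((hv.abs.mul hb).mono hsub) isCompact_uIcc).intervalIntegrable
  · exact (hlim x (uIoc_subset_I hc hd hx)).const_mul _

/-- The coefficients in variation of constants are controlled on the whole interval by their
values at one point: this is Gronwall's inequality, with a kernel that is integrable up to both
endpoints in the quasi-regular case. -/
theorem IsVariation.norm_add_norm_le (hu : ContinuousOn u T.I) (hw : ContinuousOn w T.I)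
    (hk : IntegrableOn (T.weight w u) T.I) {μ : ℂ} {φ A B g : ℝ → ℂ}
    (hV : T.IsVariation w u (fun x => μ * g x + φ x) A B)
    (hg : ∀ x ∈ T.I, g x = A x * w x + B x * u x) (hA : ContinuousOn A T.I)
    (hB : ContinuousOn B T.I) {D : ℝ} (hD : 0 ≤ D)
    (hφ : ∀ x ∈ T.I, ‖φ x‖ ≤ D * (|u x| + |w x|)) {c x : ℝ} (hc : c ∈ T.I) (hx : x ∈ T.I) :
    ‖A x‖ + ‖B x‖ ≤ (‖A c‖ + ‖B c‖ + D * ∫ t in T.I, T.weight w u t) *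
      Real.exp (‖μ‖ * ∫ t in T.I, T.weight w u t) := by
  set y : ℝ → ℝ := fun t => ‖A t‖ + ‖B t‖ with hy
  have hyc : ContinuousOn y T.I := hA.norm.add hB.norm
  have hbound : ∀ t ∈ T.I, ‖μ * g t + φ t‖ ≤ (|u t| + |w t|) * (‖μ‖ * y t + D) := by
    intro t ht
    have h1 : ‖g t‖ ≤ (|u t| + |w t|) * y t := by
      rw [hg t ht]
      refine (norm_add_le _ _).trans ?_
      rw [norm_mul, norm_mul, Complex.norm_real, Complex.norm_real, Real.norm_eq_abs,
        Real.norm_eq_abs]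
      simp only [hy]
      nlinarith [mul_nonneg (norm_nonneg (A t)) (abs_nonneg (u t)),
        mul_nonneg (norm_nonneg (B t)) (abs_nonneg (w t))]
    calc ‖μ * g t + φ t‖ ≤ ‖μ‖ * ‖g t‖ + ‖φ t‖ := (norm_add_le _ _).trans_eq (by rw [norm_mul])
      _ ≤ ‖μ‖ * ((|u t| + |w t|) * y t) + D * (|u t| + |w t|) :=
        add_le_add (mul_le_mul_of_nonneg_left h1 (norm_nonneg _)) (hφ t ht)
      _ = _ := by ring
  have hsub := uIcc_subset_I hc hx
  have hmono : ∀ s ⊆ T.I, ∫ t in s, T.weight w u t ≤ ∫ t in T.I, T.weight w u t := fun s hs =>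
    setIntegral_mono_set hk (Eventually.of_forall fun t => weight_nonneg t) hs.eventuallyLE
  have key := le_mul_exp_of_le_add_integral (k := fun t => ‖μ‖ * T.weight w u t) (y := y)
    (a := c) (b := x) (C := y c + D * ∫ t in T.I, T.weight w u t)
    (Integrable.const_mul (hk.mono_set hsub) _)
    (fun t => mul_nonneg (norm_nonneg _) (weight_nonneg t)) (hyc.mono hsub) ?_
  · have hK0 : 0 ≤ ∫ t in T.I, T.weight w u t := integral_nonneg fun t => weight_nonneg t
    refine key.trans (mul_le_mul_of_nonneg_left (Real.exp_le_exp.2 ?_) ?_)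
    · rw [integral_const_mul]
      exact mul_le_mul_of_nonneg_left (hmono _ (uIoc_subset_uIcc.trans hsub)) (norm_nonneg _)
    · simp only [hy]; positivity
  · intro t ht
    have htI := hsub ht
    have hct := uIcc_subset_I hc htI
    have hio : uIoc c t ⊆ T.I := uIoc_subset_I hc htI
    -- a bound for the increment of one coefficient; `v` stands for `u` or `w`
    have hone : ∀ v : ℝ → ℝ, ContinuousOn v T.I →
        IntegrableOn (fun s => |T.r s| * (|v s| * ((|u s| + |w s|) * (‖μ‖ * y s + D))))
          (uIoc c t) ∧
        ‖∫ s in c..t, (T.r s * v s : ℂ) * (μ * g s + φ s)‖ ≤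
          ∫ s in uIoc c t, |T.r s| * (|v s| * ((|u s| + |w s|) * (‖μ‖ * y s + D))) := by
      intro v hv
      have hr : IntegrableOn (fun x => |T.r x|) (uIcc c t) :=
        Integrable.abs (T.r_loc.integrableOn_compact_subset hct isCompact_uIcc)
      have hi := (hr.mul_continuousOn ((hv.abs.mul ((hu.abs.add hw.abs).mul
        ((hyc.const_mul ‖μ‖).add_const D))).mono hct) isCompact_uIcc).mono_set
          (uIoc_subset_uIcc (a := c) (b := t))
      refine ⟨hi, ?_⟩
      rw [intervalIntegral.norm_intervalIntegral_eq]
      refine norm_integral_le_of_norm_le hi ?_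
      rw [ae_restrict_iff' measurableSet_uIoc]
      refine Eventually.of_forall fun s hs => ?_
      rw [norm_mul, norm_mul, Complex.norm_real, Complex.norm_real, Real.norm_eq_abs,
        Real.norm_eq_abs, mul_assoc]
      have := hbound s (hio hs)
      gcongr
    have hA1 : ‖A t‖ ≤ ‖A c‖ + ‖A t - A c‖ := by
      simpa using norm_add_le (A c) (A t - A c)
    have hB1 : ‖B t‖ ≤ ‖B c‖ + ‖B t - B c‖ := by
      simpa using norm_add_le (B c) (B t - B c)
    have hA2 := (hone u hu).2
    have hB2 := (hone w hw).2
    rw [hV.left c hc t htI] at hA2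
    rw [hV.right c hc t htI, norm_neg] at hB2
    have hkt : IntegrableOn (T.weight w u) (uIoc c t) := hk.mono_set hio
    have hky : IntegrableOn (fun s => ‖μ‖ * T.weight w u s * y s) (uIoc c t) :=
      (IntegrableOn.mul_continuousOn (Integrable.const_mul (hk.mono_set hct) _) (hyc.mono hct)
        isCompact_uIcc).mono_set uIoc_subset_uIcc
    have hsum : (∫ s in uIoc c t, |T.r s| * (|u s| * ((|u s| + |w s|) * (‖μ‖ * y s + D)))) +
        ∫ s in uIoc c t, |T.r s| * (|w s| * ((|u s| + |w s|) * (‖μ‖ * y s + D))) =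
        (∫ s in uIoc c t, ‖μ‖ * T.weight w u s * y s) + D * ∫ s in uIoc c t, T.weight w u s := by
      rw [← integral_add (hone u hu).1 (hone w hw).1, ← integral_const_mul,
        ← integral_add hky (hkt.const_mul D)]
      refine integral_congr_ae (Eventually.of_forall fun s => ?_)
      simp only [weight]
      ring
    have hDm := mul_le_mul_of_nonneg_left (hmono _ hio) hD
    simp only [hy] at hsum ⊢
    linarith

/-- Proportionality of `w, u` on an interval would contradict `W(w, u) = 1`. -/
theorem IsFundamentalPair.exists_det_ne_zero (P : T.IsFundamentalPair lam w u) {c d : ℝ}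
    (hcd : c < d) (hsub : Icc c d ⊆ T.I) : ∃ x ∈ Icc c d, w c * u x - u c * w x ≠ 0 := by
  by_contra! hcon
  have hc : c ∈ T.I := hsub (left_mem_Icc.2 hcd.le)
  have hae : ∀ᵐ x : ℝ, x ∈ Ioo c d →
      (w c : ℂ) * T.quasiDeriv (fun y => (u y : ℂ)) x -
        u c * T.quasiDeriv (fun y => (w y : ℂ)) x = 0 := by
    filter_upwards [P.left.1.ae_hasDerivAt, P.right.1.ae_hasDerivAt, T.ae_p_pos] with x h1 h2 h3 hx
    have hxI := hsub (Ioo_subset_Icc_self hx)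
    have hp : (T.p x : ℂ) ≠ 0 := by exact_mod_cast (h3 hxI).ne'
    have h := ((h2 hxI).const_mul (w c : ℂ)).sub ((h1 hxI).const_mul (u c : ℂ))
    have h0 : HasDerivAt (fun _ : ℝ => (0 : ℂ)) _ x := h.congr_of_eventuallyEq <| by
      filter_upwards [Icc_mem_nhds hx.1 hx.2] with y hy
      have := hcon y hy
      simp only [Pi.sub_apply]
      exact_mod_cast this.symm
    have he := h0.unique (hasDerivAt_const x 0)
    field_simp at he
    linear_combination he
  have hpos : volume (Ioo c d) ≠ 0 := by
    rw [Real.volume_Ioo]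
    simpa using hcd
  obtain ⟨x, hx, hx0⟩ : ∃ x ∈ Ioo c d, (w c : ℂ) * T.quasiDeriv (fun y => (u y : ℂ)) x -
      u c * T.quasiDeriv (fun y => (w y : ℂ)) x = 0 := by
    by_contra! hcon'
    refine hpos (measure_mono_null (fun x hx => ?_) (ae_iff.1 hae))
    simp only [mem_ofPred_eq, Classical.not_imp]
    exact ⟨hx, hcon' x hx⟩
  have hWx := P.wronskian_eq x (hsub (Ioo_subset_Icc_self hx))
  have hWc := P.wronskian_eq c hc
  have hdx : (w c : ℂ) * u x - u c * w x = 0 := by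
    exact_mod_cast hcon x (Ioo_subset_Icc_self hx)
  simp only [wronskian] at hWx hWc
  have hu0 : (u c : ℂ) = 0 := by
    linear_combination (-(u c : ℂ)) * hWx + (u x : ℂ) * hx0 -
      T.quasiDeriv (fun y => (u y : ℂ)) x * hdx
  have hw0 : (w c : ℂ) = 0 := by
    linear_combination (-(w c : ℂ)) * hWx + (w x : ℂ) * hx0 -
      T.quasiDeriv (fun y => (w y : ℂ)) x * hdx
  rw [hu0, hw0] at hWc
  simp at hWc

/-! ### Differentiation with respect to the spectral parameter -/

theorem IsVariation.sub_div {φ ψ A B A' B' : ℝ → ℂ} (hV : T.IsVariation w u φ A B)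
    (hV' : T.IsVariation w u ψ A' B') (hu : ContinuousOn u T.I) (hw : ContinuousOn w T.I)
    (hφ : ContinuousOn φ T.I) (hψ : ContinuousOn ψ T.I) (s : ℂ) :
    T.IsVariation w u (fun x => (φ x - ψ x) / s) (fun x => (A x - A' x) / s)
      (fun x => (B x - B' x) / s) := by
  have h : ∀ v : ℝ → ℝ, ContinuousOn v T.I → ∀ c ∈ T.I, ∀ d ∈ T.I,
      ∫ x in c..d, (T.r x * v x : ℂ) * ((φ x - ψ x) / s) =
        ((∫ x in c..d, (T.r x * v x : ℂ) * φ x) - ∫ x in c..d, (T.r x * v x : ℂ) * ψ x) / s := by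
    intro v hv c hc d hd
    rw [← intervalIntegral.integral_sub (intervalIntegrable_mul hv hφ hc hd)
      (intervalIntegrable_mul hv hψ hc hd), ← intervalIntegral.integral_div]
    exact intervalIntegral.integral_congr fun x _ => by ring
  constructor
  · intro c hc d hd
    rw [h u hu c hc d hd, hV.left c hc d hd, hV'.left c hc d hd]
    ring
  · intro c hc d hd
    rw [h w hw c hc d hd, hV.right c hc d hd, hV'.right c hc d hd]
    ring

/-- Let `f n` solve `τ y = ζ n y`, with `ζ n → z`, and let the difference quotients of `f n` at
the solution `f₀` of `τ y = z y` converge pointwise to `h`. Then `h` is given by variation of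
constants with forcing term `(z - lam) h + f₀` and with bounded coefficients. -/
theorem IsFundamentalPair.exists_isVariation_of_tendsto (P : T.IsFundamentalPair lam w u)
    (hT : T.QuasiRegular) {z : ℂ} {ζ : ℕ → ℂ} (hζ : Tendsto ζ atTop (𝓝 z)) (hne : ∀ n, ζ n ≠ z)
    {f : ℕ → ℝ → ℂ} {f₀ h : ℝ → ℂ} (hf : ∀ n, T.IsSolution (ζ n) (f n)) (hf₀ : T.IsSolution z f₀)
    (hlim : ∀ x ∈ T.I, Tendsto (fun n => (f n x - f₀ x) / (ζ n - z)) atTop (𝓝 (h x))) :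
    ∃ A B : ℝ → ℂ, T.IsVariation w u (fun x => (z - lam) * h x + f₀ x) A B ∧
      (∀ x ∈ T.I, h x = A x * w x + B x * u x) ∧
      ∃ C : ℝ, ∀ x ∈ T.I, ‖A x‖ + ‖B x‖ ≤ C := by
  have hu := P.continuousOn_right
  have hw := P.continuousOn_left
  have hk := P.integrableOn_weight hT
  have huC : ContinuousOn (fun x => (u x : ℂ)) T.I := P.right.1.continuousOn
  have hwC : ContinuousOn (fun x => (w x : ℂ)) T.I := P.left.1.continuousOn
  set K := ∫ t in T.I, T.weight w u t with hK
  have hs0 : ∀ n, ζ n - z ≠ 0 := fun n => sub_ne_zero.2 (hne n)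
  have hs : Tendsto (fun n => ζ n - z) atTop (𝓝 0) := by
    simpa using hζ.sub_const z
  -- the coefficients of `f n`, of `f₀`, and of the difference quotients
  set A : ℕ → ℝ → ℂ := fun n x => -T.wronskian (fun y => (u y : ℂ)) (f n) x with hA
  set B : ℕ → ℝ → ℂ := fun n => T.wronskian (fun y => (w y : ℂ)) (f n) with hB
  set A₀ : ℝ → ℂ := fun x => -T.wronskian (fun y => (u y : ℂ)) f₀ x with hA₀
  set B₀ : ℝ → ℂ := T.wronskian (fun y => (w y : ℂ)) f₀ with hB₀
  set a : ℕ → ℝ → ℂ := fun n x => (A n x - A₀ x) / (ζ n - z) with ha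
  set b : ℕ → ℝ → ℂ := fun n x => (B n x - B₀ x) / (ζ n - z) with hb
  set q : ℕ → ℝ → ℂ := fun n x => (f n x - f₀ x) / (ζ n - z) with hq
  have hWc : ∀ {v g : ℝ → ℂ}, T.Regular v → T.Regular g → ContinuousOn (T.wronskian v g) T.I :=
    fun hv hg => ACLoc.continuousOn T (hv.aCLoc_wronskian hg)
  have hAc : ∀ n, ContinuousOn (A n) T.I := fun n => (hWc P.right.1 (hf n).1).neg
  have hBc : ∀ n, ContinuousOn (B n) T.I := fun n => hWc P.left.1 (hf n).1
  have hA₀c : ContinuousOn A₀ T.I := (hWc P.right.1 hf₀.1).neg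
  have hB₀c : ContinuousOn B₀ T.I := hWc P.left.1 hf₀.1
  have hac : ∀ n, ContinuousOn (a n) T.I := fun n => ((hAc n).sub hA₀c).div_const _
  have hbc : ∀ n, ContinuousOn (b n) T.I := fun n => ((hBc n).sub hB₀c).div_const _
  have hfc : ∀ n, ContinuousOn (f n) T.I := fun n => (hf n).1.continuousOn
  have hqc : ∀ n, ContinuousOn (q n) T.I := fun n =>
    ((hfc n).sub hf₀.1.continuousOn).div_const _
  have hfeq : ∀ n, ∀ x ∈ T.I, f n x = A n x * w x + B n x * u x := fun n x hx =>
    P.eq_add (f n) hx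
  have hqeq : ∀ n, ∀ x ∈ T.I, q n x = a n x * w x + b n x * u x := fun n x hx => by
    simp only [hq, ha, hb]
    rw [hfeq n x hx, show f₀ x = A₀ x * w x + B₀ x * u x from P.eq_add f₀ hx]
    ring
  have hV : ∀ n, T.IsVariation w u (fun x => (ζ n - lam) * f n x + 0) (A n) (B n) := fun n =>
    P.isVariation (hf n).1 ((hf n).2.mono fun x hx hxI => by rw [hx hxI]; ring)
  have hV₀ : T.IsVariation w u (fun x => (z - lam) * f₀ x) A₀ B₀ :=
    P.isVariation hf₀.1 (hf₀.2.mono fun x hx hxI => by rw [hx hxI]; ring)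
  have hv : ∀ n, T.IsVariation w u (fun x => (z - lam) * q n x + f n x) (a n) (b n) := fun n => by
    have := (hV n).sub_div hV₀ hu hw (((hfc n).const_mul _).add_const 0)
      (hf₀.1.continuousOn.const_mul _) (ζ n - z)
    refine cast (congrArg (fun φ => T.IsVariation w u φ (a n) (b n)) (funext fun x => ?_)) this
    simp only [hq]
    field_simp [hs0 n]
    ring
  have hfq : ∀ n x, f n x = f₀ x + (ζ n - z) * q n x := fun n x => by
    simp only [hq]; field_simp [hs0 n]; ring
  have hflim : ∀ x ∈ T.I, Tendsto (fun n => f n x) atTop (𝓝 (f₀ x)) := fun x hx => by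
    have := (hs.mul (hlim x hx)).const_add (f₀ x)
    rw [zero_mul, add_zero] at this
    exact this.congr fun n => (hfq n x).symm
  set ψ : ℕ → ℝ → ℂ := fun n x => (z - lam) * q n x + f n x with hψ
  have hψc : ∀ n, ContinuousOn (ψ n) T.I := fun n => ((hqc n).const_mul _).add (hfc n)
  have hψlim : ∀ x ∈ T.I, Tendsto (fun n => ψ n x) atTop (𝓝 ((z - lam) * h x + f₀ x)) :=
    fun x hx => ((hlim x hx).const_mul _).add (hflim x hx)
  -- uniform bounds on a small interval, where integrals of `ψ n` converge
  obtain ⟨c, d, hcd, hsub, M, hM⟩ := exists_Icc_forall_le_of_pointwise_bounded T.isOpen_I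
    T.nonempty_I (F := fun n x => ‖ψ n x‖) (fun n => (hψc n).norm) fun x hx => by
      obtain ⟨M, hM⟩ := (hψlim x hx).norm.bddAbove_range
      exact ⟨M, fun n => hM (mem_range_self n)⟩
  obtain ⟨d', hd', hdet⟩ := P.exists_det_ne_zero hcd hsub
  have hc : c ∈ T.I := hsub (left_mem_Icc.2 hcd.le)
  have hdI : d' ∈ T.I := hsub hd'
  have hsmall : ∀ v : ℝ → ℝ, ContinuousOn v T.I →
      Tendsto (fun n => ∫ x in c..d', (T.r x * v x : ℂ) * ψ n x) atTop
        (𝓝 (∫ x in c..d', (T.r x * v x : ℂ) * ((z - lam) * h x + f₀ x))) := fun v hv =>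
    tendsto_intervalIntegral_mul hv (continuousOn_const (c := M)) hψc hψlim hc hdI
      fun n x hx => hM n x (by
        rw [uIoc_of_le hd'.1] at hx
        exact ⟨hx.1.le, hx.2.trans hd'.2⟩)
  -- the values of `q n` at two points determine the coefficients at `c`, by Cramer's rule
  have hdet' : (w c * u d' - u c * w d' : ℂ) ≠ 0 := by exact_mod_cast hdet
  have hY : ∃ Y, Tendsto (fun n => a n c * w d' + b n c * u d') atTop (𝓝 Y) := by
    refine ⟨_, (((hlim d' hdI).sub ((hsmall u hu).mul_const (w d' : ℂ))).add
      ((hsmall w hw).mul_const (u d' : ℂ))).congr fun n => ?_⟩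
    change q n d' - _ + _ = _
    rw [(hv n).left c hc d' hdI, (hv n).right c hc d' hdI, hqeq n d' hdI]
    ring
  obtain ⟨Y, hY⟩ := hY
  have hX : Tendsto (fun n => a n c * w c + b n c * u c) atTop (𝓝 (h c)) :=
    (hlim c hc).congr fun n => hqeq n c hc
  obtain ⟨α, hα⟩ : ∃ α, Tendsto (fun n => a n c) atTop (𝓝 α) := by
    refine ⟨_, (((hX.mul_const (u d' : ℂ)).sub (hY.mul_const (u c : ℂ))).div_const
      (w c * u d' - u c * w d' : ℂ)).congr fun n => ?_⟩
    rw [div_eq_iff hdet']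
    ring
  obtain ⟨β, hβ⟩ : ∃ β, Tendsto (fun n => b n c) atTop (𝓝 β) := by
    refine ⟨_, (((hY.mul_const (w c : ℂ)).sub (hX.mul_const (w d' : ℂ))).div_const
      (w c * u d' - u c * w d' : ℂ)).congr fun n => ?_⟩
    rw [div_eq_iff hdet']
    ring
  -- bounds on the whole interval
  have hK0 : 0 ≤ K := integral_nonneg fun t => weight_nonneg t
  have hAlim : Tendsto (fun n => A n c) atTop (𝓝 (A₀ c)) := by
    have := (hs.mul hα).const_add (A₀ c)
    rw [zero_mul, add_zero] at this
    refine this.congr fun n => ?_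
    simp only [ha]; field_simp [hs0 n]; ring
  have hBlim : Tendsto (fun n => B n c) atTop (𝓝 (B₀ c)) := by
    have := (hs.mul hβ).const_add (B₀ c)
    rw [zero_mul, add_zero] at this
    refine this.congr fun n => ?_
    simp only [hb]; field_simp [hs0 n]; ring
  obtain ⟨M₁, hM₁⟩ := (hAlim.norm.add hBlim.norm).bddAbove_range
  obtain ⟨M₂, hM₂⟩ := (hζ.sub_const (lam : ℂ)).norm.bddAbove_range
  obtain ⟨M₃, hM₃⟩ := (hα.norm.add hβ.norm).bddAbove_range
  replace hM₁ : ∀ n, ‖A n c‖ + ‖B n c‖ ≤ M₁ := fun n => hM₁ (mem_range_self n)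
  replace hM₂ : ∀ n, ‖ζ n - lam‖ ≤ M₂ := fun n => hM₂ (mem_range_self n)
  replace hM₃ : ∀ n, ‖a n c‖ + ‖b n c‖ ≤ M₃ := fun n => hM₃ (mem_range_self n)
  have hM₁0 : 0 ≤ M₁ := le_trans (by positivity) (hM₁ 0)
  set D := M₁ * Real.exp (M₂ * K) with hD
  have hD0 : 0 ≤ D := by positivity
  have hcomb : ∀ (x : ℝ) (s t : ℂ) (E : ℝ), ‖s‖ + ‖t‖ ≤ E →
      ‖s * w x + t * u x‖ ≤ E * (|u x| + |w x|) := fun x s t E hE => by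
    refine (norm_add_le _ _).trans ?_
    rw [norm_mul, norm_mul, Complex.norm_real, Complex.norm_real, Real.norm_eq_abs,
      Real.norm_eq_abs]
    nlinarith [mul_nonneg (norm_nonneg s) (abs_nonneg (u x)), abs_nonneg (u x), abs_nonneg (w x),
      mul_nonneg (norm_nonneg t) (abs_nonneg (w x)),
      mul_le_mul_of_nonneg_right hE (add_nonneg (abs_nonneg (u x)) (abs_nonneg (w x)))]
  have hfD : ∀ n, ∀ x ∈ T.I, ‖f n x‖ ≤ D * (|u x| + |w x|) := fun n x hx => by
    rw [hfeq n x hx]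
    refine hcomb x _ _ D ?_
    refine ((hV n).norm_add_norm_le (φ := fun _ => 0) hu hw hk (hfeq n) (hAc n) (hBc n) le_rfl
      (fun x _ => by simp) hc hx).trans ?_
    rw [zero_mul, add_zero]
    exact mul_le_mul (hM₁ n) (Real.exp_le_exp.2 (mul_le_mul_of_nonneg_right (hM₂ n) hK0))
      (Real.exp_pos _).le hM₁0
  set C := (M₃ + D * K) * Real.exp (‖z - lam‖ * K) with hC
  have habC : ∀ n, ∀ x ∈ T.I, ‖a n x‖ + ‖b n x‖ ≤ C := fun n x hx => by
    refine ((hv n).norm_add_norm_le hu hw hk (hqeq n) (hac n) (hbc n) hD0 (hfD n) hc hx).trans ?_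
    exact mul_le_mul_of_nonneg_right (add_le_add (hM₃ n) le_rfl) (Real.exp_pos _).le
  have hψle : ∀ n, ∀ x ∈ T.I, ‖ψ n x‖ ≤ (‖z - lam‖ * C + D) * (|u x| + |w x|) := fun n x hx => by
    have h1 : ‖q n x‖ ≤ C * (|u x| + |w x|) := by
      rw [hqeq n x hx]
      exact hcomb x _ _ C (habC n x hx)
    calc ‖ψ n x‖ ≤ ‖z - lam‖ * ‖q n x‖ + ‖f n x‖ := (norm_add_le _ _).trans_eq (by rw [norm_mul])
      _ ≤ ‖z - lam‖ * (C * (|u x| + |w x|)) + D * (|u x| + |w x|) :=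
        add_le_add (mul_le_mul_of_nonneg_left h1 (norm_nonneg _)) (hfD n x hx)
      _ = _ := by ring
  -- hence the integrals and the coefficients converge everywhere
  have hconv : ∀ v : ℝ → ℝ, ContinuousOn v T.I → ∀ c ∈ T.I, ∀ d ∈ T.I,
      Tendsto (fun n => ∫ x in c..d, (T.r x * v x : ℂ) * ψ n x) atTop
        (𝓝 (∫ x in c..d, (T.r x * v x : ℂ) * ((z - lam) * h x + f₀ x))) :=
    fun v hv c hc d hd => tendsto_intervalIntegral_mul hv
      ((hu.abs.add hw.abs).const_mul (‖z - lam‖ * C + D)) hψc hψlim hc hd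
      fun n x hx => hψle n x (uIoc_subset_I hc hd hx)
  have halim : ∀ x ∈ T.I, ∃ s, Tendsto (fun n => a n x) atTop (𝓝 s) := fun x hx =>
    ⟨_, (hα.add (hconv u hu c hc x hx)).congr fun n => by
      rw [(hv n).left c hc x hx]; ring⟩
  have hblim : ∀ x ∈ T.I, ∃ s, Tendsto (fun n => b n x) atTop (𝓝 s) := fun x hx =>
    ⟨_, (hβ.sub (hconv w hw c hc x hx)).congr fun n => by
      rw [(hv n).right c hc x hx]; ring⟩
  choose! a' ha' using halim
  choose! b' hb' using hblim
  refine ⟨a', b', ⟨fun c hc d hd => ?_, fun c hc d hd => ?_⟩, fun x hx => ?_, C, fun x hx => ?_⟩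
  · exact tendsto_nhds_unique (hconv u hu c hc d hd)
      (((ha' d hd).sub (ha' c hc)).congr fun n => ((hv n).left c hc d hd).symm)
  · exact tendsto_nhds_unique (hconv w hw c hc d hd)
      (((hb' d hd).sub (hb' c hc)).neg.congr fun n => ((hv n).right c hc d hd).symm)
  · exact tendsto_nhds_unique (hlim x hx)
      ((((ha' x hx).mul_const _).add ((hb' x hx).mul_const _)).congr
        fun n => (hqeq n x hx).symm)
  · exact le_of_tendsto ((ha' x hx).norm.add (hb' x hx).norm)
      (Eventually.of_forall fun n => habC n x hx)

/-! ### The maximal domain and its boundary values -/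

theorem Regular.memDomMax {g G : ℝ → ℂ} (hg : T.Regular g)
    (hG : ∀ᵐ x : ℝ, x ∈ T.I → T.tau g x = G x)
    (hg2 : IntegrableOn (fun x => T.r x * ‖g x‖ ^ 2) T.I)
    (hG2 : IntegrableOn (fun x => T.r x * ‖G x‖ ^ 2) T.I) : T.MemDomMax g := by
  refine ⟨hg, hg2, hG2.congr_fun_ae ?_⟩
  rw [EventuallyEq, ae_restrict_iff' T.measurableSet_I]
  filter_upwards [hG] with x hx hxI
  rw [hx hxI]

/-- `L²(r dx)` is closed under linear combinations. -/
theorem integrableOn_sq_add {f g : ℝ → ℂ} (hf : AEStronglyMeasurable f (volume.restrict T.I))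
    (hg : AEStronglyMeasurable g (volume.restrict T.I))
    (hf2 : IntegrableOn (fun x => T.r x * ‖f x‖ ^ 2) T.I)
    (hg2 : IntegrableOn (fun x => T.r x * ‖g x‖ ^ 2) T.I) (s t : ℂ) :
    IntegrableOn (fun x => T.r x * ‖s * f x + t * g x‖ ^ 2) T.I := by
  have hm := T.aestronglyMeasurable_r.mul ((((hf.const_mul s).add (hg.const_mul t)).norm).pow 2)
  refine Integrable.mono' ((hf2.const_mul (2 * ‖s‖ ^ 2)).add (hg2.const_mul (2 * ‖t‖ ^ 2))) hm ?_
  rw [ae_restrict_iff' T.measurableSet_I]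
  filter_upwards [T.ae_r_pos] with x h hx
  have h0 := (h hx).le
  rw [Real.norm_of_nonneg (by positivity), Pi.add_apply]
  have h1 : ‖s * f x + t * g x‖ ≤ ‖s‖ * ‖f x‖ + ‖t‖ * ‖g x‖ := by
    simpa only [norm_mul] using norm_add_le (s * f x) (t * g x)
  have h2 : ‖s * f x + t * g x‖ ^ 2 ≤ 2 * (‖s‖ * ‖f x‖) ^ 2 + 2 * (‖t‖ * ‖g x‖) ^ 2 := by
    refine (pow_le_pow_left₀ (norm_nonneg _) h1 2).trans ?_
    nlinarith [sq_nonneg (‖s‖ * ‖f x‖ - ‖t‖ * ‖g x‖)]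
  calc T.r x * ‖s * f x + t * g x‖ ^ 2
      ≤ T.r x * (2 * (‖s‖ * ‖f x‖) ^ 2 + 2 * (‖t‖ * ‖g x‖) ^ 2) :=
        mul_le_mul_of_nonneg_left h2 h0
    _ = _ := by ring

theorem Regular.aestronglyMeasurable {g : ℝ → ℂ} (hg : T.Regular g) :
    AEStronglyMeasurable g (volume.restrict T.I) :=
  hg.continuousOn.aestronglyMeasurable T.measurableSet_I

theorem Regular.aestronglyMeasurable_tau {g : ℝ → ℂ} (hg : T.Regular g) :
    AEStronglyMeasurable (T.tau g) (volume.restrict T.I) := by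
  have hr : AEStronglyMeasurable (fun x => (T.r x : ℂ)⁻¹) (volume.restrict T.I) :=
    (Complex.continuous_ofReal.comp_aestronglyMeasurable
      T.aestronglyMeasurable_r).aemeasurable.inv.aestronglyMeasurable
  have hq : AEStronglyMeasurable (fun x => (T.q x : ℂ)) (volume.restrict T.I) :=
    Complex.continuous_ofReal.comp_aestronglyMeasurable
      (LocallyIntegrableOn.aestronglyMeasurable T.q_loc)
  exact hr.mul ((stronglyMeasurable_deriv _).aestronglyMeasurable.neg.add
    (hq.mul hg.aestronglyMeasurable))

theorem QuasiRegular.memDomMax (hT : T.QuasiRegular) {z : ℂ} {f : ℝ → ℂ}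
    (hf : T.IsSolution z f) : T.MemDomMax f := by
  have h := hT.integrableOn hf
  refine hf.1.memDomMax hf.2 h ((integrableOn_sq_add hf.1.aestronglyMeasurable
    hf.1.aestronglyMeasurable h h z 0).congr (Eventually.of_forall fun x => ?_))
  simp

/-- Every function in the maximal domain has generalized boundary values at an endpoint with a
principal solution. -/
theorem MemDomMax.hasBdryValues {g : ℝ → ℂ} (hg : T.MemDomMax g) (hT : T.QuasiRegular)
    {l : Filter ℝ} {S : ℝ → Set ℝ} (hE : T.IsEndpoint l S) (P : T.IsFundamentalPair lam w u)
    {c : ℝ} (hc : c ∈ T.I) (hu : ∀ x ∈ S c, u x ≠ 0)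
    (hint : ∫⁻ x in S c, ENNReal.ofReal (1 / (T.p x * u x ^ 2)) = ⊤) :
    T.HasBdryValues l w u g := by
  have hφm : AEStronglyMeasurable (fun x => 1 * T.tau g x + -lam * g x)
      (volume.restrict T.I) :=
    (hg.1.aestronglyMeasurable_tau.const_mul _).add (hg.1.aestronglyMeasurable.const_mul _)
  have hφ2 := integrableOn_sq_add hg.1.aestronglyMeasurable_tau hg.1.aestronglyMeasurable
    hg.2.2 hg.2.1 1 (-lam)
  exact hE.hasBdryValues P hc hu hint hg.1 (Eventually.of_forall fun x _ => by ring)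
    (integrableOn_mul P.right.1.aestronglyMeasurable hφm (hT.integrableOn P.right) hφ2)
    (integrableOn_mul P.left.1.aestronglyMeasurable hφm (hT.integrableOn P.left) hφ2)

/-- The Wronskian of the generalized boundary values is the limit of the Wronskian; in particular
it does not depend on the pair `w, u`. -/
theorem HasBdryValues.tendsto_wronskian {l : Filter ℝ} {f g : ℝ → ℂ}
    (hf : T.HasBdryValues l w u f) (hg : T.HasBdryValues l w u g)
    (P : T.IsFundamentalPair lam w u) (hl : ∀ᶠ x in l, x ∈ T.I) :
    Tendsto (T.wronskian f g) l (𝓝 (T.genWronskian l w u f g)) := by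
  refine ((hf.1.mul hg.2.1).sub (hf.2.1.mul hg.1)).congr' ?_
  filter_upwards [hl] with x hx
  exact (P.wronskian_eq_coeff f g hx).symm

/-- The limit of difference quotients of solutions with respect to the spectral parameter lies in
the maximal domain and solves the differentiated equation. -/
theorem IsFundamentalPair.memDomMax_of_tendsto (P : T.IsFundamentalPair lam w u)
    (hT : T.QuasiRegular) {z : ℂ} {ζ : ℕ → ℂ} (hζ : Tendsto ζ atTop (𝓝 z)) (hne : ∀ n, ζ n ≠ z)
    {f : ℕ → ℝ → ℂ} {f₀ h : ℝ → ℂ} (hf : ∀ n, T.IsSolution (ζ n) (f n)) (hf₀ : T.IsSolution z f₀)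
    (hlim : ∀ x ∈ T.I, Tendsto (fun n => (f n x - f₀ x) / (ζ n - z)) atTop (𝓝 (h x))) :
    T.MemDomMax h ∧ ∀ᵐ x : ℝ, x ∈ T.I → T.tau h x = z * h x + f₀ x := by
  obtain ⟨A, B, hV, heq, C, hC⟩ := P.exists_isVariation_of_tendsto hT hζ hne hf hf₀ hlim
  have hhm : AEStronglyMeasurable h (volume.restrict T.I) := by
    refine aestronglyMeasurable_of_tendsto_ae atTop
      (f := fun n x => (f n x - f₀ x) / (ζ n - z)) (fun n => ?_)
      ((ae_restrict_iff' T.measurableSet_I).2 (Eventually.of_forall hlim))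
    exact (((hf n).1.continuousOn.sub hf₀.1.continuousOn).div_const _).aestronglyMeasurable
      T.measurableSet_I
  have hh2 : IntegrableOn (fun x => T.r x * ‖h x‖ ^ 2) T.I := by
    refine Integrable.mono' ((P.integrableOn_weight hT).const_mul (C ^ 2))
      (T.aestronglyMeasurable_r.mul (hhm.norm.pow 2)) ?_
    rw [ae_restrict_iff' T.measurableSet_I]
    refine Eventually.of_forall fun x hx => ?_
    have h1 : ‖h x‖ ≤ C * (|u x| + |w x|) := by
      rw [heq x hx]
      refine (norm_add_le _ _).trans ?_
      rw [norm_mul, norm_mul, Complex.norm_real, Complex.norm_real, Real.norm_eq_abs,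
        Real.norm_eq_abs]
      nlinarith [mul_nonneg (norm_nonneg (A x)) (abs_nonneg (u x)),
        mul_nonneg (norm_nonneg (B x)) (abs_nonneg (w x)),
        mul_le_mul_of_nonneg_right (hC x hx) (add_nonneg (abs_nonneg (u x)) (abs_nonneg (w x)))]
    rw [norm_mul, norm_pow, norm_norm, Real.norm_eq_abs, weight]
    calc |T.r x| * ‖h x‖ ^ 2 ≤ |T.r x| * (C * (|u x| + |w x|)) ^ 2 := by gcongr
      _ = _ := by ring
  have hf₀m := hf₀.1.aestronglyMeasurable
  have hf₀2 := hT.integrableOn hf₀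
  have hφm : AEStronglyMeasurable (fun x => (z - lam) * h x + f₀ x) (volume.restrict T.I) :=
    (hhm.const_mul _).add hf₀m
  have hφ2 : IntegrableOn (fun x => T.r x * ‖(z - lam) * h x + f₀ x‖ ^ 2) T.I := by
    simpa only [one_mul] using integrableOn_sq_add hhm hf₀m hh2 hf₀2 (z - lam) 1
  have hloc : ∀ {F : ℝ → ℂ}, IntegrableOn F T.I → ∀ c ∈ T.I, ∀ d ∈ T.I,
      IntervalIntegrable F volume c d := fun hF c hc d hd =>
    (hF.mono_set (uIcc_subset_I hc hd)).intervalIntegrable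
  obtain ⟨hreg, htau⟩ := P.regular_of_isVariation hV
    (hloc (integrableOn_mul P.right.1.aestronglyMeasurable hφm (hT.integrableOn P.right) hφ2))
    (hloc (integrableOn_mul P.left.1.aestronglyMeasurable hφm (hT.integrableOn P.left) hφ2)) heq
  have htau' : ∀ᵐ x : ℝ, x ∈ T.I → T.tau h x = z * h x + f₀ x := by
    filter_upwards [htau] with x hx hxI
    rw [hx hxI]
    ring
  refine ⟨hreg.memDomMax htau' hh2 ?_, htau'⟩
  simpa only [one_mul] using integrableOn_sq_add hhm hf₀m hh2 hf₀2 z 1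

end SturmLiouville

theorem lemma3p2 (T : SturmLiouville) (hT : T.QuasiRegular)
    -- normalized principal and nonprincipal solutions at the two endpoints
    (lam : ℝ) (ua wa ub wb : ℝ → ℝ)
    (hua : T.IsPrincipalLeft lam ua) (hwa : T.IsNormalizedPartner lam wa ua)
    (hub : T.IsPrincipalRight lam ub) (hwb : T.IsNormalizedPartner lam wb ub)
    (z : ℂ) (f₁ : ℝ → ℂ) (f₂ : ℂ → ℝ → ℂ)
    (hf₁ : T.IsSolution z f₁)
    (hf₂ : ∀ᶠ ζ in 𝓝 z, T.IsSolution ζ (f₂ ζ))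
    (hdiff : ∀ x ∈ T.I, DifferentiableAt ℂ (fun ζ => f₂ ζ x) z) :
    let df₂ : ℝ → ℂ := fun x => deriv (fun ζ => f₂ ζ x) z
    -- all the quantities in the identity exist
    T.MemDomMax f₁ ∧ T.MemDomMax df₂ ∧
    T.HasBdryValues T.atLeft wa ua f₁ ∧ T.HasBdryValues T.atRight wb ub f₁ ∧
    T.HasBdryValues T.atLeft wa ua df₂ ∧ T.HasBdryValues T.atRight wb ub df₂ ∧
    IntegrableOn (fun x => (T.r x : ℂ) * (f₁ x * f₂ z x)) T.I ∧
    -- the identity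
    ∫ x in T.I, (T.r x : ℂ) * (f₁ x * f₂ z x) =
      T.genWronskian T.atLeft wa ua f₁ df₂ - T.genWronskian T.atRight wb ub f₁ df₂ := by
  intro df₂
  have Pa : T.IsFundamentalPair lam wa ua := ⟨hwa.1, hua.1, hwa.2⟩
  have Pb : T.IsFundamentalPair lam wb ub := ⟨hwb.1, hub.1, hwb.2⟩
  have hEa := SturmLiouville.isEndpoint_atLeft (T := T)
  have hEb := SturmLiouville.isEndpoint_atRight (T := T)
  obtain ⟨-, ca, hca, hua0, hinta⟩ := hua
  obtain ⟨-, cb, hcb, hub0, hintb⟩ := hub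
  have hf₂z : T.IsSolution z (f₂ z) := hf₂.self_of_nhds
  -- one sequence of parameters suffices to identify the derivative
  obtain ⟨ζ, hζ, hζsol⟩ : ∃ ζ : ℕ → ℂ, Tendsto ζ atTop (𝓝[≠] z) ∧
      ∀ n, T.IsSolution (ζ n) (f₂ (ζ n)) ∧ ζ n ≠ z := by
    obtain ⟨ζ, hζ⟩ := exists_seq_tendsto (𝓝[≠] z)
    obtain ⟨N, hN⟩ := eventually_atTop.1
      (hζ.eventually ((hf₂.filter_mono nhdsWithin_le_nhds).and self_mem_nhdsWithin))
    exact ⟨fun n => ζ (n + N), hζ.comp (tendsto_add_atTop_nat N), fun n => hN _ (by omega)⟩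
  obtain ⟨hdom, htau⟩ := Pa.memDomMax_of_tendsto hT (hζ.mono_right nhdsWithin_le_nhds)
    (fun n => (hζsol n).2) (fun n => (hζsol n).1) hf₂z (h := df₂) fun x hx => by
      refine ((hdiff x hx).hasDerivAt.tendsto_slope.comp hζ).congr fun n => ?_
      simp only [Function.comp_apply, slope_def_field]
  have hdom₁ : T.MemDomMax f₁ := hT.memDomMax hf₁
  have b1a := hdom₁.hasBdryValues hT hEa Pa hca (fun x hx => hua0 x hx.1 hx.2) hinta
  have b1b := hdom₁.hasBdryValues hT hEb Pb hcb (fun x hx => hub0 x hx.1 hx.2) hintb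
  have b2a := hdom.hasBdryValues hT hEa Pa hca (fun x hx => hua0 x hx.1 hx.2) hinta
  have b2b := hdom.hasBdryValues hT hEb Pb hcb (fun x hx => hub0 x hx.1 hx.2) hintb
  have hint : IntegrableOn (fun x => (T.r x : ℂ) * (f₁ x * f₂ z x)) T.I := by
    simpa only [mul_assoc] using SturmLiouville.integrableOn_mul hf₁.1.aestronglyMeasurable
      hf₂z.1.aestronglyMeasurable (hT.integrableOn hf₁) (hT.integrableOn hf₂z)
  refine ⟨hdom₁, hdom, b1a, b1b, b2a, b2b, hint, ?_⟩
  -- exhaust `(a,b)` by compact intervals and apply Lagrange's identity on each of them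
  have := hEa.neBot
  have := hEb.neBot
  have := hEa.isCountablyGenerated
  have := hEb.isCountablyGenerated
  have hcov : AECover (volume.restrict T.I) (T.atLeft ×ˢ T.atRight) (fun e => Icc e.1 e.2) := by
    refine ⟨?_, fun e => measurableSet_Icc⟩
    rw [ae_restrict_iff' T.measurableSet_I]
    refine Eventually.of_forall fun t ht => ?_
    filter_upwards [(hEa.eventually_mem t ht).prod_mk (hEb.eventually_mem t ht)] with e he
    exact ⟨he.1.2, he.2.2⟩
  have hlim₁ := hcov.integral_tendsto_of_countably_generated hint
  have hWa := (b1a.tendsto_wronskian b2a Pa hEa.eventually_mem_I).comp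
    (tendsto_fst (f := T.atLeft) (g := T.atRight))
  have hWb := (b1b.tendsto_wronskian b2b Pb hEb.eventually_mem_I).comp
    (tendsto_snd (f := T.atLeft) (g := T.atRight))
  refine tendsto_nhds_unique hlim₁ ((hWa.sub hWb).congr' ?_)
  filter_upwards [(hEa.eventually_mem ca hca).prod_mk (hEb.eventually_mem ca hca)] with e he
  have hle : e.1 ≤ e.2 := he.1.2.trans he.2.2
  have h1 : e.1 ∈ T.I := he.1.1
  have h2 : e.2 ∈ T.I := he.2.1
  have hsub : Icc e.1 e.2 ⊆ T.I := by
    rw [← uIcc_of_le hle]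
    exact SturmLiouville.uIcc_subset_I h1 h2
  have hL := hf₁.1.integral_wronskian hdom.1 hf₁.2 htau h1 h2
  rw [Measure.restrict_restrict measurableSet_Icc, inter_eq_left.2 hsub,
    integral_Icc_eq_integral_Ioc, ← intervalIntegral.integral_of_le hle]
  simp only [Function.comp_apply]
  rw [← neg_sub, ← hL, ← intervalIntegral.integral_neg]
  exact intervalIntegral.integral_congr fun x _ => by ring
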